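/- Let $q\in(0,2]$, $c\ge 1$, and let $f,g:\mathbb R\to\mathbb R$ be continuous and non-decreasing, with $f>0$. Write $g^\pm=\max\{\pm g,0\}$; the limit $\lim_{t\to+\infty}g(t)\in(-\infty,+\infty]$ exists. For $a\in\mathbb R$ consider the Cauchy problem $$\varphi''+\frac{c-1}{r}\varphi'=f(\varphi)+g(\varphi)|\varphi'|^q,\qquad \varphi(0)=a,\quad \varphi'(0)=0. \qquad (1)$$ A solution of (1) on $[0,R)$, $0<R\le+\infty$, is a function $\varphi\in C^2((0,R))\cap C([0,R))$ satisfying the equation on $(0,R)$, with $\varphi(0)=a$, $0=\varphi'(0)=\lim_{r\to0^+}\varphi'(r)$, and such that $\lim_{r\to0^+}\varphi''(r)$ exists in $\mathbb R$. It is maximal if it is not the restriction of a solution of (1) on $[0,R')$ for some $R'>R$. Consider the conditions $$q\le1\quad\text{and}\quad\int_0^{+\infty}\frac{dt}{(t f(t))^{1/2}+(t g^+(t))^{1/(2-q)}}=+\infty,\qquad (2)$$ $$\int_0^{+\infty}\left(\int_0^t e^{-2\int_s^t\left(\frac{g^-(\tau)}{f(\tau)}\right)^{2/q}f(\tau)\,d\tau}f(s)\,ds\right)^{-1/2}dt=+\infty,\qquad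 (3)$$ $$\int_0^{+\infty}\left[\frac{1}{(t f(t))^{1/2}}+\frac{1}{f(t)^{1/q}}\right]dt=+\infty.\qquad (4)$$ Let $a\in\mathbb R$ and let $\varphi$, defined on $[0,R)$, be any maximal solution of (1). Then: (i) if $\lim_{t\to+\infty}g(t)>0$, then $R=+\infty$ if and only if (2) holds; (ii) if $\lim_{t\to+\infty}g(t)\le0$, then $R=+\infty$ if and only if (3) holds; (iii) if $\lim_{t\to+\infty}g(t)<0$, then (3) is equivalent to (4). -/

import Mathlib

open MeasureTheory Filter Topology

/-- `φ` solves `φ'' + (c - 1) / r * φ' = f φ + g φ * |φ'| ^ q` on `[0, R)`, `0 < R ≤ +∞`, with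
`φ 0 = a` and `φ' 0 = 0`: it is continuous on `[0, R)` and `C²` on `(0, R)`, its right derivative
at `0` vanishes and is the limit of `φ'` at `0+`, and `φ''` has a finite limit at `0+`.
Only the values of `φ` on `[0, R)` matter. -/
structure IsRadialSolution (f g : ℝ → ℝ) (c q a : ℝ) (R : EReal) (φ : ℝ → ℝ) : Prop where
  pos : 0 < R
  contDiffOn : ContDiffOn ℝ 2 φ {r : ℝ | 0 < r ∧ (r : EReal) < R}
  continuousOn : ContinuousOn φ {r : ℝ | 0 ≤ r ∧ (r : EReal) < R}
  map_zero : φ 0 = a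
  deriv_zero : HasDerivWithinAt φ 0 (Set.Ici 0) 0
  tendsto_deriv : Tendsto (deriv φ) (𝓝[>] 0) (𝓝 0)
  tendsto_deriv_deriv : ∃ L : ℝ, Tendsto (deriv (deriv φ)) (𝓝[>] 0) (𝓝 L)
  ode : ∀ r : ℝ, 0 < r → (r : EReal) < R →
    deriv (deriv φ) r + (c - 1) / r * deriv φ r = f (φ r) + g (φ r) * |deriv φ r| ^ q

/-- A solution on `[0, R)` is maximal if it is not the restriction of a solution on a strictly
larger interval `[0, R')`. -/
def IsMaximalRadialSolution (f g : ℝ → ℝ) (c q a : ℝ) (R : EReal) (φ : ℝ → ℝ) : Prop :=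
  IsRadialSolution f g c q a R φ ∧
    ¬ ∃ (R' : EReal) (ψ : ℝ → ℝ), R < R' ∧ IsRadialSolution f g c q a R' ψ ∧
      Set.EqOn ψ φ {r : ℝ | 0 ≤ r ∧ (r : EReal) < R}

/-- `q ≤ 1` and `∫₀^∞ dt / ((t f)^{1/2} + (t g⁺)^{1/(2-q)}) = +∞`. -/
def GrowthConditionPos (f g : ℝ → ℝ) (q : ℝ) : Prop :=
  q ≤ 1 ∧
    ∫⁻ t in Set.Ioi (0 : ℝ), ENNReal.ofReal
      (1 / ((t * f t) ^ (1 / 2 : ℝ) + (t * (g t)⁺) ^ (1 / (2 - q)))) = ⊤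

/-- `∫₀^∞ (∫₀ᵗ exp (-2 ∫ₛᵗ (g⁻ / f)^{2/q} f dτ) f(s) ds)^{-1/2} dt = +∞`. -/
def GrowthConditionNonpos (f g : ℝ → ℝ) (q : ℝ) : Prop :=
  ∫⁻ t in Set.Ioi (0 : ℝ), ENNReal.ofReal
    (1 / (∫ s in (0 : ℝ)..t,
      Real.exp (-2 * ∫ τ in s..t, ((g τ)⁻ / f τ) ^ (2 / q) * f τ) * f s) ^ (1 / 2 : ℝ)) = ⊤

/-- `∫₀^∞ ((t f)^{-1/2} + f^{-1/q}) dt = +∞`. -/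
def GrowthConditionNeg (f : ℝ → ℝ) (q : ℝ) : Prop :=
  ∫⁻ t in Set.Ioi (0 : ℝ), ENNReal.ofReal
    (1 / (t * f t) ^ (1 / 2 : ℝ) + 1 / (f t) ^ (1 / q)) = ⊤

/-! Write u = φ'. Since f > 0, u is positive on (0, R), so u may be regarded as a function of the
value t = φ, and the time spent between two values is ∫ dt / u. If u ≤ C D(φ) near a blow-up, then ∫
dt / D converges at infinity. If u ≥ ε D(φ) along a global solution, then ∫ dt / D diverges. The
theorem follows once u is compared with the right D.

Two facts link this to R. A global solution tends to infinity, because u stays above a positive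
constant. A maximal solution with R < ∞ is unbounded: if φ were bounded then u would be too (this
uses q ≤ 2), and the solution could be continued.

When lim g > 0, D is the denominator in (2): it balances u² against t f(t) and u² against t g(t)
u^q. A global solution forces q ≤ 1, since otherwise eventually u' ≥ κ u^q and u blows up in finite
time. When lim g ≤ 0, put k = (g⁻/f)^(2/q). Without radial damping, y = u² as a function of t
satisfies y' = 2f (1 - (k y)^(q/2)). The inner integral W of (3) solves W' = f (1 - 2 k W), and
barriers show that y is comparable to W, so D = W^(1/2).

The damping (c - 1) u / r has a good sign for upper bounds. For lower bounds, suppose that ∫ dt / D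
converges. Then the nondecreasing D is superlinear, and this makes the damping a small fraction of
the source.

For (iii), g⁻ lies between positive constants on [0, ∞), and W(t) is comparable to min(t f, f^(2/q))
up to constants and the dilation t ↦ 2t, which preserves divergence. -/

/-! ### Monotonicity and barrier arguments -/

theorem le_of_hasDerivAt_nonneg {h h' : ℝ → ℝ} {x y : ℝ} (hxy : x ≤ y)
    (hd : ∀ s ∈ Set.Icc x y, HasDerivAt h (h' s) s) (hn : ∀ s ∈ Set.Icc x y, 0 ≤ h' s) :
    h x ≤ h y := by
  refine monotoneOn_of_hasDerivWithinAt_nonneg (D := Set.Icc x y) (f' := h') (convex_Icc x y)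
    (fun s hs => (hd s hs).continuousAt.continuousWithinAt) (fun s hs => ?_) (fun s hs => ?_)
    (Set.left_mem_Icc.2 hxy) (Set.right_mem_Icc.2 hxy) hxy
  · exact (hd s (interior_subset hs)).hasDerivWithinAt
  · exact hn s (interior_subset hs)

/-- A differentiable function that starts nonnegative and does not decrease where it is negative
stays nonnegative. -/
theorem nonneg_of_barrier {h h' : ℝ → ℝ} {x y : ℝ} (hxy : x ≤ y)
    (hd : ∀ s ∈ Set.Icc x y, HasDerivAt h (h' s) s) (h0 : 0 ≤ h x)
    (hb : ∀ s ∈ Set.Icc x y, h s < 0 → 0 ≤ h' s) : 0 ≤ h y := by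
  by_contra! hneg
  have hc : ContinuousOn h (Set.Icc x y) := fun s hs => (hd s hs).continuousAt.continuousWithinAt
  have hcomp : IsCompact (Set.Icc x y ∩ h ⁻¹' Set.Ici 0) :=
    isCompact_Icc.of_isClosed_subset (hc.preimage_isClosed_of_isClosed isClosed_Icc isClosed_Ici)
      Set.inter_subset_left
  -- z is the last point where h ≥ 0. Beyond it h is negative, hence nondecreasing, so h y ≥ h z ≥
  -- 0.
  obtain ⟨z, ⟨hz, hz0⟩, hzmax⟩ := hcomp.exists_isGreatest ⟨x, ⟨le_rfl, hxy⟩, h0⟩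
  have hz0 : 0 ≤ h z := hz0
  have hlt : ∀ s ∈ Set.Ioc z y, h s < 0 := by
    intro s hs
    by_contra! hs0
    exact absurd (hzmax ⟨⟨hz.1.trans hs.1.le, hs.2⟩, hs0⟩) (not_le.2 hs.1)
  have hsub : Set.Icc z y ⊆ Set.Icc x y := Set.Icc_subset_Icc_left hz.1
  have : h z ≤ h y := by
    refine monotoneOn_of_hasDerivWithinAt_nonneg (D := Set.Icc z y) (f' := h') (convex_Icc z y)
      (hc.mono hsub) (fun s hs => ?_) (fun s hs => ?_)
      (Set.left_mem_Icc.2 hz.2) (Set.right_mem_Icc.2 hz.2) hz.2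
    · exact (hd s (hsub (interior_subset hs))).hasDerivWithinAt
    · rw [interior_Icc] at hs
      exact hb s (hsub ⟨hs.1.le, hs.2.le⟩) (hlt s ⟨hs.1, hs.2.le⟩)
  linarith

/-- A differentiable function that starts positive and has positive derivative at its zeros stays
positive. -/
theorem pos_of_deriv_pos_at_zeros {h h' : ℝ → ℝ} {x y : ℝ} (hxy : x ≤ y)
    (hd : ∀ s ∈ Set.Icc x y, HasDerivAt h (h' s) s) (h0 : 0 < h x)
    (hb : ∀ s ∈ Set.Icc x y, h s = 0 → 0 < h' s) : 0 < h y := by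
  by_contra! hneg
  have hc : ContinuousOn h (Set.Icc x y) := fun s hs => (hd s hs).continuousAt.continuousWithinAt
  have hcomp : IsCompact (Set.Icc x y ∩ h ⁻¹' Set.Iic 0) :=
    isCompact_Icc.of_isClosed_subset (hc.preimage_isClosed_of_isClosed isClosed_Icc isClosed_Iic)
      Set.inter_subset_left
  -- z is the first point where h ≤ 0, so h z = 0. The slopes from the left are negative there,
  -- against a positive derivative.
  obtain ⟨z, ⟨hz, hz0⟩, hzmin⟩ := hcomp.exists_isLeast ⟨y, ⟨hxy, le_rfl⟩, hneg⟩
  have hz0 : h z ≤ 0 := hz0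
  have hxz : x < z := lt_of_le_of_ne hz.1 (by rintro rfl; linarith)
  have hlt : ∀ s ∈ Set.Ico x z, 0 < h s := by
    intro s hs
    by_contra! hs0
    exact absurd (hzmin ⟨⟨hs.1, hs.2.le.trans hz.2⟩, hs0⟩) (not_le.2 hs.2)
  have hev : ∀ᶠ s in 𝓝[<] z, 0 < h s := by
    filter_upwards [Ico_mem_nhdsLT hxz] with s hs using hlt s hs
  have hzz : h z = 0 := le_antisymm hz0 <|
    ge_of_tendsto ((hd z hz).continuousAt.tendsto.mono_left nhdsWithin_le_nhds)
      (hev.mono fun _ h => h.le)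
  have hpos := hb z hz hzz
  have hslope := hasDerivAt_iff_tendsto_slope_left_right.1 (hd z hz) |>.1
  obtain ⟨s, hs, hs1, hs2⟩ := ((hslope.eventually (lt_mem_nhds hpos)).and
    (hev.and self_mem_nhdsWithin)).exists
  rw [slope_def_field, hzz] at hs
  have : (h s - 0) / (s - z) < 0 := div_neg_of_pos_of_neg (by linarith) (by
    have : s < z := hs2
    linarith)
  linarith

/-! ### Integral tests along a trajectory -/

/-- If `w ∘ φ * φ'` is bounded above on a bounded interval on which `φ` is unbounded, then `w` is
integrable at infinity. -/
theorem lintegral_lt_top_of_deriv_le {φ u w : ℝ → ℝ} {r R t C : ℝ}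
    (hφ : ∀ s ∈ Set.Ico r R, HasDerivAt φ (u s) s) (ht : ∀ s ∈ Set.Ico r R, t ≤ φ s)
    (hunb : ∀ B, ∃ s ∈ Set.Ico r R, B ≤ φ s)
    (hw : ContinuousOn w (Set.Ioi 0)) (ht0 : 0 < t) (hwpos : ∀ s, t ≤ s → 0 ≤ w s)
    (hC : ∀ s ∈ Set.Ico r R, w (φ s) * u s ≤ C) :
    ∫⁻ s in Set.Ioi t, ENNReal.ofReal (w s) < ⊤ := by
  set H : ℝ → ℝ := fun x => ∫ s in t..x, w s with hH
  have hwi : ∀ x, t ≤ x → IntervalIntegrable w volume t x := fun x hx =>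
    ContinuousOn.intervalIntegrable (hw.mono (by
      rw [Set.uIcc_of_le hx]; intro s hs; exact ht0.trans_le hs.1))
  have hHd : ∀ x, t ≤ x → HasDerivAt H (w x) x := fun x hx =>
    intervalIntegral.integral_hasDerivAt_right (hwi x hx)
      (hw.stronglyMeasurableAtFilter isOpen_Ioi x (ht0.trans_le hx))
      (hw.continuousAt (Ioi_mem_nhds (ht0.trans_le hx)))
  -- H is a primitive of w, so (H ∘ φ)' = w(φ) u ≤ |C| and H ∘ φ stays bounded on the bounded
  -- interval.
  have hbd : ∀ s ∈ Set.Ico r R, H (φ s) ≤ H (φ r) + |C| * (R - r) := by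
    intro s hs
    have := le_of_hasDerivAt_nonneg (h := fun x => |C| * x - H (φ x))
      (h' := fun x => |C| * 1 - w (φ x) * u x) hs.1
      (fun x hx => by
        have hx' : x ∈ Set.Ico r R := ⟨hx.1, hx.2.trans_lt hs.2⟩
        exact ((hasDerivAt_id x).const_mul |C|).sub ((hHd _ (ht x hx')).comp x (hφ x hx')))
      (fun x hx => by
        have hx' : x ∈ Set.Ico r R := ⟨hx.1, hx.2.trans_lt hs.2⟩
        have := hC x hx'
        have := le_abs_self C
        linarith)
    have h2 : |C| * (s - r) ≤ |C| * (R - r) :=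
      mul_le_mul_of_nonneg_left (by linarith [hs.2]) (abs_nonneg C)
    linarith
  have hint : IntegrableOn w (Set.Ioi t) := by
    choose! x hx hxn using fun n : ℕ => hunb n
    refine integrableOn_Ioi_of_intervalIntegral_norm_bounded (H (φ r) + |C| * (R - r)) t
      (b := fun n : ℕ => φ (x n)) (l := atTop) (fun n => ?_)
      (tendsto_atTop_mono hxn tendsto_natCast_atTop_atTop) (.of_forall fun n => ?_)
    · exact (intervalIntegrable_iff_integrableOn_Ioc_of_le (ht _ (hx n))).1 (hwi _ (ht _ (hx n)))
    · refine le_trans (le_of_eq ?_) (hbd _ (hx n))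
      refine intervalIntegral.integral_congr fun s hs => ?_
      rw [Set.uIcc_of_le (ht _ (hx n))] at hs
      exact abs_of_nonneg (hwpos s hs.1)
  have := hint.2
  rw [hasFiniteIntegral_iff_norm] at this
  refine lt_of_le_of_lt (lintegral_mono fun s => ENNReal.ofReal_le_ofReal (le_abs_self _)) this

/-- If `w ∘ φ * φ'` is bounded below by a positive constant on a half-line, then `w` is not
integrable at infinity. -/
theorem lintegral_eq_top_of_le_deriv {φ u w : ℝ → ℝ} {r t ε : ℝ}
    (hφ : ∀ s, r ≤ s → HasDerivAt φ (u s) s) (ht : ∀ s, r ≤ s → t ≤ φ s)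
    (hw : ContinuousOn w (Set.Ioi 0)) (ht0 : 0 < t) (hwpos : ∀ s, t ≤ s → 0 ≤ w s)
    (hε : 0 < ε) (hC : ∀ s, r ≤ s → ε ≤ w (φ s) * u s) :
    ∫⁻ s in Set.Ioi t, ENNReal.ofReal (w s) = ⊤ := by
  by_contra hne
  have hint : IntegrableOn w (Set.Ioi t) := by
    refine ⟨(hw.mono (Set.Ioi_subset_Ioi ht0.le)).aestronglyMeasurable measurableSet_Ioi, ?_⟩
    rw [hasFiniteIntegral_iff_norm]
    refine lt_of_le_of_lt (le_of_eq ?_) (lt_top_iff_ne_top.2 hne)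
    refine setLIntegral_congr_fun measurableSet_Ioi fun s hs => ?_
    simp only [Real.norm_eq_abs, abs_of_nonneg (hwpos s (le_of_lt hs))]
  set H : ℝ → ℝ := fun x => ∫ s in t..x, w s with hH
  have hwi : ∀ x, t ≤ x → IntervalIntegrable w volume t x := fun x hx =>
    ContinuousOn.intervalIntegrable (hw.mono (by
      rw [Set.uIcc_of_le hx]; intro s hs; exact ht0.trans_le hs.1))
  have hHd : ∀ x, t ≤ x → HasDerivAt H (w x) x := fun x hx =>
    intervalIntegral.integral_hasDerivAt_right (hwi x hx)
      (hw.stronglyMeasurableAtFilter isOpen_Ioi x (ht0.trans_le hx))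
      (hw.continuousAt (Ioi_mem_nhds (ht0.trans_le hx)))
  have hbd : ∀ x, t ≤ x → H x ≤ ∫ s in Set.Ioi t, w s := by
    intro x hx
    rw [hH]
    simp only
    rw [intervalIntegral.integral_of_le hx]
    exact setIntegral_mono_set hint
      ((ae_restrict_mem measurableSet_Ioi).mono fun s hs => hwpos s (le_of_lt hs))
      (Set.Ioc_subset_Ioi_self.eventuallyLE)
  have hgrow : ∀ s, r ≤ s → H (φ r) + ε * (s - r) ≤ H (φ s) := by
    intro s hs
    have := le_of_hasDerivAt_nonneg (h := fun x => H (φ x) - ε * x)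
      (h' := fun x => w (φ x) * u x - ε * 1) hs
      (fun x hx => ((hHd _ (ht x hx.1)).comp x (hφ x hx.1)).sub
          ((hasDerivAt_id x).const_mul ε))
      (fun x hx => by
        have := hC x hx.1
        linarith)
    linarith
  set M := ∫ s in Set.Ioi t, w s
  have hM : H (φ r) ≤ M := hbd _ (ht r le_rfl)
  -- At this time the linear lower bound for H ∘ φ equals M + 1, beyond the total integral M.
  have h1 := hgrow (r + (M - H (φ r) + 1) / ε) (by
    have : 0 ≤ (M - H (φ r) + 1) / ε := div_nonneg (by linarith) hε.le
    linarith)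
  have h2 := hbd _ (ht (r + (M - H (φ r) + 1) / ε) (by
    have : 0 ≤ (M - H (φ r) + 1) / ε := div_nonneg (by linarith) hε.le
    linarith))
  have h3 : ε * (r + (M - H (φ r) + 1) / ε - r) = M - H (φ r) + 1 := by
    field_simp
    ring
  linarith

/-- A function dominated by a multiple of `t ^ (-1 / 2)` near zero diverges on `(0, ∞)` as soon as
its integral does not converge at infinity. -/
theorem lintegral_Ioi_eq_top_iff {w : ℝ → ℝ} {t K : ℝ} (ht : 0 < t)
    (hK : ∀ s ∈ Set.Ioc 0 t, w s ≤ K * s ^ (-(1 / 2) : ℝ)) :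
    ∫⁻ s in Set.Ioi (0 : ℝ), ENNReal.ofReal (w s) = ⊤ ↔
      ∫⁻ s in Set.Ioi t, ENNReal.ofReal (w s) = ⊤ := by
  have hsplit : Set.Ioi (0 : ℝ) = Set.Ioc 0 t ∪ Set.Ioi t := (Set.Ioc_union_Ioi_eq_Ioi ht.le).symm
  have hfin : ∫⁻ s in Set.Ioc 0 t, ENNReal.ofReal (w s) < ⊤ := by
    have hi : IntegrableOn (fun s : ℝ => K * s ^ (-(1 / 2) : ℝ)) (Set.Ioc 0 t) :=
      ((intervalIntegrable_iff_integrableOn_Ioc_of_le ht.le).1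
        (intervalIntegral.intervalIntegrable_rpow' (by norm_num))).const_mul K
    refine lt_of_le_of_lt (setLIntegral_mono' measurableSet_Ioc fun s hs =>
      ENNReal.ofReal_le_ofReal ((hK s hs).trans (le_abs_self _))) ?_
    have := hi.2
    rw [hasFiniteIntegral_iff_norm] at this
    exact this
  rw [hsplit, lintegral_union measurableSet_Ioi
    (Set.disjoint_left.2 fun s hs hs' => absurd hs.2 (not_le.2 hs')), ENNReal.add_eq_top]
  exact ⟨fun h => h.resolve_left hfin.ne, Or.inr⟩

/-! ### Radial solutions as a first order flow: sign and growth of the derivative -/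

/-- The first order system satisfied by a radial solution `φ` and its derivative `u` on `(0, R)`. -/
structure IsRadialFlow (f g : ℝ → ℝ) (c q a : ℝ) (R : EReal) (φ u : ℝ → ℝ) : Prop where
  hasDerivAt_fst : ∀ r : ℝ, 0 < r → (r : EReal) < R → HasDerivAt φ (u r) r
  hasDerivAt_snd : ∀ r : ℝ, 0 < r → (r : EReal) < R →
    HasDerivAt u (f (φ r) + g (φ r) * u r ^ q - (c - 1) / r * u r) r
  pos : ∀ r : ℝ, 0 < r → (r : EReal) < R → 0 < u r
  le_fst : ∀ r : ℝ, 0 < r → (r : EReal) < R → a ≤ φ r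
  tendsto_snd : Tendsto u (𝓝[>] 0) (𝓝 0)

theorem EReal.exists_pos_coe_lt {R : EReal} (h : 0 < R) : ∃ δ : ℝ, 0 < δ ∧ (δ : EReal) < R := by
  obtain ⟨x, hx, hxR⟩ := EReal.lt_iff_exists_real_btwn.1 h
  exact ⟨x, by exact_mod_cast hx, hxR⟩

theorem isOpen_setOf_pos_and_coe_lt (R : EReal) : IsOpen {r : ℝ | 0 < r ∧ (r : EReal) < R} :=
  (isOpen_Ioi (a := (0 : ℝ))).inter (isOpen_Iio.preimage continuous_coe_real_ereal)

theorem coe_lt_of_le {s r : ℝ} {R : EReal} (hsr : s ≤ r) (hr : (r : EReal) < R) :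
    (s : EReal) < R := lt_of_le_of_lt (EReal.coe_le_coe_iff.2 hsr) hr

namespace IsRadialSolution

variable {f g φ : ℝ → ℝ} {c q a : ℝ} {R : EReal}

theorem hasDerivAt (h : IsRadialSolution f g c q a R φ) {r : ℝ} (hr : 0 < r)
    (hrR : (r : EReal) < R) : HasDerivAt φ (deriv φ r) r :=
  ((h.contDiffOn.differentiableOn (by norm_num)).differentiableAt
    ((isOpen_setOf_pos_and_coe_lt R).mem_nhds ⟨hr, hrR⟩)).hasDerivAt

theorem hasDerivAt_deriv (h : IsRadialSolution f g c q a R φ) {r : ℝ} (hr : 0 < r)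
    (hrR : (r : EReal) < R) :
    HasDerivAt (deriv φ) (f (φ r) + g (φ r) * |deriv φ r| ^ q - (c - 1) / r * deriv φ r) r := by
  have h1 : ContDiffOn ℝ 1 (deriv φ) {r : ℝ | 0 < r ∧ (r : EReal) < R} :=
    ((contDiffOn_succ_iff_deriv_of_isOpen (n := 1) (isOpen_setOf_pos_and_coe_lt R)).1
      (by simpa [one_add_one_eq_two] using h.contDiffOn)).2.2
  have h2 := ((h1.differentiableOn (by norm_num)).differentiableAt
    ((isOpen_setOf_pos_and_coe_lt R).mem_nhds ⟨hr, hrR⟩)).hasDerivAt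
  have := h.ode r hr hrR
  exact h2.congr_deriv (by linarith)

/-- The integrating factor r^(c-1) turns the equation into (r^(c-1) φ')' = r^(c-1) (f(φ) +
g(φ)|φ'|^q). Near 0 the bracket is close to f(a) > 0, so r^(c-1) φ' increases strictly from its
limit 0. -/
theorem exists_deriv_pos (h : IsRadialSolution f g c q a R φ) (hf : Continuous f)
    (hfpos : ∀ t, 0 < f t) (hg : Continuous g) (hq : 0 < q) (hc : 1 ≤ c) :
    ∃ δ : ℝ, 0 < δ ∧ ∀ r, 0 < r → r < δ → 0 < deriv φ r := by
  obtain ⟨d, hd, hdR⟩ := EReal.exists_pos_coe_lt h.pos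
  have hφ0 : Tendsto φ (𝓝[>] 0) (𝓝 a) := by
    rw [← h.map_zero]
    exact (h.deriv_zero.continuousWithinAt.mono Set.Ioi_subset_Ici_self)
  have hlim : Tendsto (fun r => f (φ r) + g (φ r) * |deriv φ r| ^ q) (𝓝[>] 0) (𝓝 (f a)) := by
    have h1 := (hf.tendsto a).comp hφ0
    have h2 := (hg.tendsto a).comp hφ0
    have h3 : Tendsto (fun r => |deriv φ r| ^ q) (𝓝[>] 0) (𝓝 0) := by
      have := (h.tendsto_deriv.abs).rpow_const (p := q) (Or.inr hq.le)
      simpa [Real.zero_rpow hq.ne'] using this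
    simpa using h1.add (h2.mul h3)
  have hev : ∀ᶠ r in 𝓝[>] (0 : ℝ), 0 < f (φ r) + g (φ r) * |deriv φ r| ^ q :=
    hlim.eventually (lt_mem_nhds (hfpos a))
  obtain ⟨d', hd', hpos⟩ := (mem_nhdsGT_iff_exists_Ioo_subset).1 hev
  have hd' : 0 < d' := hd'
  set δ := min d d' with hδ
  set v : ℝ → ℝ := fun r => r ^ (c - 1) * deriv φ r with hv
  have hvd : ∀ r ∈ Set.Ioo 0 δ, HasDerivAt v
      (r ^ (c - 1) * (f (φ r) + g (φ r) * |deriv φ r| ^ q)) r := by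
    intro r hr
    have hrR := coe_lt_of_le (hr.2.le.trans (min_le_left d d')) hdR
    have := (Real.hasDerivAt_rpow_const (p := c - 1) (Or.inl hr.1.ne')).mul
      (h.hasDerivAt_deriv hr.1 hrR)
    refine this.congr_deriv ?_
    rw [Real.rpow_sub_one hr.1.ne']
    ring
  have hmono : StrictMonoOn v (Set.Ioo 0 δ) := by
    refine strictMonoOn_of_hasDerivWithinAt_pos (convex_Ioo 0 δ)
      (fun r hr => (hvd r hr).continuousAt.continuousWithinAt)
      (fun r hr => (hvd r (interior_subset hr)).hasDerivWithinAt) (fun r hr => ?_)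
    have hr := interior_subset hr
    exact mul_pos (Real.rpow_pos_of_pos hr.1 _) (hpos ⟨hr.1, hr.2.trans_le (min_le_right _ _)⟩)
  have hv0 : Tendsto v (𝓝[>] 0) (𝓝 0) := by
    refine squeeze_zero_norm' ?_ (by simpa using h.tendsto_deriv.norm)
    filter_upwards [Ioo_mem_nhdsGT (zero_lt_one (α := ℝ))] with r hr
    rw [hv, norm_mul, Real.norm_of_nonneg (Real.rpow_nonneg hr.1.le _)]
    exact mul_le_of_le_one_left (norm_nonneg _)
      (Real.rpow_le_one hr.1.le hr.2.le (by linarith))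
  refine ⟨δ, lt_min hd hd', fun r hr hrδ => ?_⟩
  have h1 : 0 ≤ v (r / 2) := by
    refine le_of_tendsto hv0 ?_
    filter_upwards [Ioo_mem_nhdsGT (half_pos hr)] with s hs
    exact (hmono ⟨hs.1, by linarith [hs.2]⟩ ⟨by linarith, by linarith⟩ hs.2).le
  have h2 : v (r / 2) < v r := hmono ⟨by linarith, by linarith⟩ ⟨hr, hrδ⟩ (by linarith)
  exact pos_of_mul_pos_right (h1.trans_lt h2) (Real.rpow_nonneg hr.le _)

/-- Where φ' vanishes the equation reads φ'' = f(φ) > 0, so φ' cannot return to zero. -/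
theorem deriv_pos (h : IsRadialSolution f g c q a R φ) (hf : Continuous f)
    (hfpos : ∀ t, 0 < f t) (hg : Continuous g) (hq : 0 < q) (hc : 1 ≤ c)
    {r : ℝ} (hr : 0 < r) (hrR : (r : EReal) < R) : 0 < deriv φ r := by
  obtain ⟨δ, hδ, hpos⟩ := h.exists_deriv_pos hf hfpos hg hq hc
  have hm : 0 < min r (δ / 2) := lt_min hr (half_pos hδ)
  refine pos_of_deriv_pos_at_zeros (min_le_left r (δ / 2))
    (fun s hs => h.hasDerivAt_deriv (hm.trans_le hs.1) (coe_lt_of_le hs.2 hrR))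
    (hpos _ hm ((min_le_right _ _).trans_lt (half_lt_self hδ))) (fun s hs hs0 => ?_)
  simp [hs0, Real.zero_rpow hq.ne', hfpos]

theorem isRadialFlow (h : IsRadialSolution f g c q a R φ) (hf : Continuous f)
    (hfpos : ∀ t, 0 < f t) (hg : Continuous g) (hq : 0 < q) (hc : 1 ≤ c) :
    IsRadialFlow f g c q a R φ (deriv φ) where
  hasDerivAt_fst r hr hrR := h.hasDerivAt hr hrR
  hasDerivAt_snd r hr hrR := by
    have := h.hasDerivAt_deriv hr hrR
    rwa [abs_of_pos (h.deriv_pos hf hfpos hg hq hc hr hrR)] at this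
  pos r hr hrR := h.deriv_pos hf hfpos hg hq hc hr hrR
  le_fst r hr hrR := by
    have hφ0 : Tendsto φ (𝓝[>] 0) (𝓝 a) := by
      rw [← h.map_zero]
      exact (h.deriv_zero.continuousWithinAt.mono Set.Ioi_subset_Ici_self)
    refine le_of_tendsto hφ0 ?_
    filter_upwards [Ioo_mem_nhdsGT hr] with s hs
    exact le_of_hasDerivAt_nonneg hs.2.le
      (fun x hx => h.hasDerivAt (hs.1.trans_le hx.1) (coe_lt_of_le hx.2 hrR))
      (fun x hx => (h.deriv_pos hf hfpos hg hq hc (hs.1.trans_le hx.1)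
        (coe_lt_of_le hx.2 hrR)).le)
  tendsto_snd := h.tendsto_deriv

end IsRadialSolution

namespace IsRadialFlow

variable {f g φ u : ℝ → ℝ} {c q a : ℝ} {R : EReal}

theorem mono (h : IsRadialFlow f g c q a R φ u) {s r : ℝ} (hs : 0 < s) (hsr : s ≤ r)
    (hr : (r : EReal) < R) : φ s ≤ φ r :=
  le_of_hasDerivAt_nonneg hsr
    (fun x hx => h.hasDerivAt_fst x (hs.trans_le hx.1) (coe_lt_of_le hx.2 hr))
    (fun x hx => (h.pos x (hs.trans_le hx.1) (coe_lt_of_le hx.2 hr)).le)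

/-- For u below a small x, the gradient term and the damping together are less than f(a) ≤ f(φ), so
u' > 0: small values of u act as a barrier. The bound makes global solutions tend to infinity and
keeps u away from 0 at the end of a bounded interval. -/
theorem exists_pos_le (h : IsRadialFlow f g c q a R φ u) (hfm : Monotone f)
    (hfpos : ∀ t, 0 < f t) (hgm : Monotone g) (hq : 0 < q) (hc : 1 ≤ c) {r₀ : ℝ} (hr₀ : 0 < r₀)
    (hr₀R : (r₀ : EReal) < R) :
    ∃ δ : ℝ, 0 < δ ∧ ∀ r : ℝ, r₀ ≤ r → (r : EReal) < R → δ ≤ u r := by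
  have hlim : Tendsto (fun x : ℝ => |g a| * x ^ q + (c - 1) / r₀ * x) (𝓝[>] 0) (𝓝 0) := by
    have h1 : Tendsto (fun x : ℝ => x) (𝓝[>] 0) (𝓝 0) :=
      tendsto_nhdsWithin_of_tendsto_nhds tendsto_id
    have h2 := h1.rpow_const (p := q) (Or.inr hq.le)
    rw [Real.zero_rpow hq.ne'] at h2
    simpa using (h2.const_mul |g a|).add (h1.const_mul ((c - 1) / r₀))
  obtain ⟨x, hx, hx0⟩ := ((hlim.eventually (gt_mem_nhds (hfpos a))).and
    self_mem_nhdsWithin).exists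
  have hx0 : 0 < x := hx0
  refine ⟨min x (u r₀), lt_min hx0 (h.pos r₀ hr₀ hr₀R), fun r hr hrR => ?_⟩
  have := nonneg_of_barrier (h := fun s => u s - min x (u r₀)) hr
    (fun s hs => (h.hasDerivAt_snd s (hr₀.trans_le hs.1) (coe_lt_of_le hs.2 hrR)).sub_const _)
    (sub_nonneg.2 (min_le_right _ _)) (fun s hs hneg => ?_)
  · linarith
  · have hsp : 0 < s := hr₀.trans_le hs.1
    have hsR := coe_lt_of_le hs.2 hrR
    have hup := h.pos s hsp hsR
    have hux : u s ≤ x := by linarith [min_le_left x (u r₀)]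
    have haφ := h.le_fst s hsp hsR
    have h1 := hfm haφ
    have h2 : -(|g a| * x ^ q) ≤ g (φ s) * u s ^ q := by
      have e1 : u s ^ q ≤ x ^ q := Real.rpow_le_rpow hup.le hux hq.le
      have e2 : 0 ≤ u s ^ q := Real.rpow_nonneg hup.le _
      have e3 := mul_le_mul_of_nonneg_right (hgm haφ) e2
      have e4 := mul_le_mul_of_nonneg_right (neg_abs_le (g a)) e2
      have e5 := mul_le_mul_of_nonneg_left e1 (abs_nonneg (g a))
      linarith
    have h3 : (c - 1) / s * u s ≤ (c - 1) / r₀ * x :=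
      mul_le_mul (div_le_div_of_nonneg_left (by linarith) hr₀ hs.1) hux hup.le
        (div_nonneg (by linarith) hr₀.le)
    linarith

theorem tendsto_atTop (h : IsRadialFlow f g c q a ⊤ φ u) (hfm : Monotone f)
    (hfpos : ∀ t, 0 < f t) (hgm : Monotone g) (hq : 0 < q) (hc : 1 ≤ c) :
    Tendsto φ atTop atTop := by
  obtain ⟨δ, hδ, hu⟩ := h.exists_pos_le hfm hfpos hgm hq hc zero_lt_one (EReal.coe_lt_top 1)
  have hle : ∀ r : ℝ, 1 ≤ r → φ 1 - δ + δ * r ≤ φ r := by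
    intro r hr
    have := le_of_hasDerivAt_nonneg (h := fun s => φ s - δ * s) (h' := fun s => u s - δ * 1) hr
      (fun s hs => (h.hasDerivAt_fst s (zero_lt_one.trans_le hs.1) (EReal.coe_lt_top s)).sub
        ((hasDerivAt_id s).const_mul δ))
      (fun s hs => by
        have := hu s hs.1 (EReal.coe_lt_top s)
        linarith)
    linarith
  refine tendsto_atTop_mono' _ ((eventually_ge_atTop 1).mono hle) ?_
  exact tendsto_atTop_add_const_left _ _ (tendsto_id.const_mul_atTop hδ)

end IsRadialFlow

/-! ### Continuation: a maximal solution on a bounded interval is unbounded -/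

/-- Local solvability of `α' = f(t) A(α) + g(t) B(α) + C(α)` with continuous scalar coefficients
`f`, `g` and continuously differentiable vector fields `A`, `B`, `C`. -/
theorem exists_hasDerivAt_smul_add {E : Type*} [NormedAddCommGroup E] [NormedSpace ℝ E]
    [CompleteSpace E] {f g : ℝ → ℝ} (hf : Continuous f) (hg : Continuous g) {A B C : E → E} {x : E}
    (hA : ContDiffAt ℝ 1 A x) (hB : ContDiffAt ℝ 1 B x) (hC : ContDiffAt ℝ 1 C x) (t₀ : ℝ) :
    ∃ α : ℝ → E, α t₀ = x ∧
      ∀ᶠ t in 𝓝 t₀, HasDerivAt α (f t • A (α t) + g t • B (α t) + C (α t)) t := by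
  obtain ⟨KA, sA, hsA, hLA⟩ := hA.exists_lipschitzOnWith
  obtain ⟨KB, sB, hsB, hLB⟩ := hB.exists_lipschitzOnWith
  obtain ⟨KC, sC, hsC, hLC⟩ := hC.exists_lipschitzOnWith
  obtain ⟨d, hd, hds⟩ := Metric.nhds_basis_closedBall.mem_iff.1
    (inter_mem (inter_mem hsA hsB) hsC)
  obtain ⟨M, hM⟩ := (isCompact_Icc (a := t₀ - 1) (b := t₀ + 1)).exists_bound_of_continuousOn
    (f := f) hf.continuousOn
  obtain ⟨N, hN⟩ := (isCompact_Icc (a := t₀ - 1) (b := t₀ + 1)).exists_bound_of_continuousOn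
    (f := g) hg.continuousOn
  have hM0 : 0 ≤ M := (norm_nonneg _).trans (hM t₀ ⟨by linarith, by linarith⟩)
  have hN0 : 0 ≤ N := (norm_nonneg _).trans (hN t₀ ⟨by linarith, by linarith⟩)
  set F : ℝ → E → E := fun t y => f t • A y + g t • B y + C y with hF
  set K : ℝ := M * KA + N * KB + KC with hK
  have hK0 : 0 ≤ K := by positivity
  set P : ℝ := M * ‖A x‖ + N * ‖B x‖ + ‖C x‖ + K * d with hP
  have hP0 : 0 ≤ P := by positivity
  -- ε ≤ 1 keeps t where M and N bound the coefficients; P ε ≤ d keeps the solution in the ball of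
  -- radius d. The +1 avoids division by zero.
  set ε : ℝ := min 1 (d / (P + 1)) with hε
  have hε0 : 0 < ε := lt_min one_pos (by positivity)
  have hsub : Set.Icc (t₀ - ε) (t₀ + ε) ⊆ Set.Icc (t₀ - 1) (t₀ + 1) := by
    have : ε ≤ 1 := min_le_left _ _
    exact Set.Icc_subset_Icc (by linarith) (by linarith)
  have hlip : ∀ t ∈ Set.Icc (t₀ - ε) (t₀ + ε), ∀ y ∈ Metric.closedBall x d,
      ∀ z ∈ Metric.closedBall x d, ‖F t y - F t z‖ ≤ K * ‖y - z‖ := by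
    intro t ht y hy z hz
    have e1 : ‖A y - A z‖ ≤ KA * ‖y - z‖ := hLA.norm_sub_le (hds hy).1.1 (hds hz).1.1
    have e2 : ‖B y - B z‖ ≤ KB * ‖y - z‖ := hLB.norm_sub_le (hds hy).1.2 (hds hz).1.2
    have e3 : ‖C y - C z‖ ≤ KC * ‖y - z‖ := hLC.norm_sub_le (hds hy).2 (hds hz).2
    have e4 : F t y - F t z = f t • (A y - A z) + g t • (B y - B z) + (C y - C z) := by
      simp only [hF, smul_sub]
      abel
    have e5 : ‖f t • (A y - A z)‖ ≤ M * (KA * ‖y - z‖) := by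
      rw [norm_smul]
      exact mul_le_mul (hM t (hsub ht)) e1 (norm_nonneg _) hM0
    have e6 : ‖g t • (B y - B z)‖ ≤ N * (KB * ‖y - z‖) := by
      rw [norm_smul]
      exact mul_le_mul (hN t (hsub ht)) e2 (norm_nonneg _) hN0
    rw [e4]
    refine (norm_add₃_le).trans ?_
    rw [hK]
    linarith
  have hxm : x ∈ Metric.closedBall x d := Metric.mem_closedBall_self hd.le
  have hPL : IsPicardLindelof F (tmin := t₀ - ε) (tmax := t₀ + ε)
      ⟨t₀, by constructor <;> linarith⟩ x ⟨d, hd.le⟩ 0 ⟨P, hP0⟩ ⟨K, hK0⟩ := by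
    refine ⟨fun t ht => LipschitzOnWith.of_dist_le_mul fun y hy z hz => ?_, fun y _ => ?_,
      fun t ht y hy => ?_, ?_⟩
    · rw [dist_eq_norm, dist_eq_norm]
      exact hlip t ht y hy z hz
    · simp only [hF]
      fun_prop
    · have h1 := hlip t ht y hy x hxm
      have h2 : ‖y - x‖ ≤ d := by
        have : dist y x ≤ d := hy
        rwa [dist_eq_norm] at this
      have h3 : ‖F t x‖ ≤ M * ‖A x‖ + N * ‖B x‖ + ‖C x‖ := by
        refine norm_add₃_le.trans ?_
        rw [norm_smul, norm_smul]
        have := mul_le_mul_of_nonneg_right (hM t (hsub ht)) (norm_nonneg (A x))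
        have := mul_le_mul_of_nonneg_right (hN t (hsub ht)) (norm_nonneg (B x))
        linarith
      have h4 : ‖F t y‖ ≤ ‖F t x‖ + ‖F t y - F t x‖ := by
        have := norm_add_le (F t x) (F t y - F t x)
        rwa [add_sub_cancel] at this
      have h5 := mul_le_mul_of_nonneg_left h2 hK0
      change ‖F t y‖ ≤ P
      linarith
    · have h1 : max (t₀ + ε - t₀) (t₀ - (t₀ - ε)) = ε := by
        rw [add_sub_cancel_left, sub_sub_cancel, max_self]
      change P * max (t₀ + ε - t₀) (t₀ - (t₀ - ε)) ≤ d - 0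
      rw [h1, sub_zero]
      calc P * ε ≤ (P + 1) * (d / (P + 1)) :=
            mul_le_mul (by linarith) (min_le_right _ _) hε0.le (by linarith)
        _ = d := by field_simp
  obtain ⟨α, hα0, hα⟩ := hPL.exists_eq_forall_mem_Icc_hasDerivWithinAt₀
  refine ⟨α, hα0, ?_⟩
  filter_upwards [Ioo_mem_nhds (show t₀ - ε < t₀ by linarith) (show t₀ < t₀ + ε by linarith)]
    with t ht
  exact (hα t ⟨ht.1.le, ht.2.le⟩).hasDerivAt (Icc_mem_nhds ht.1 ht.2)

/-- Local solvability of the radial equation at a point where the derivative is positive. The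
equation is solved with `φ` as independent variable, in which it is locally Lipschitz. -/
theorem exists_radial_extension {f g : ℝ → ℝ} (hf : Continuous f) (hg : Continuous g) (c q : ℝ)
    {r b β : ℝ} (hr : 0 < r) (hβ : 0 < β) :
    ∃ ψ v : ℝ → ℝ, ψ r = b ∧ v r = β ∧ ∀ᶠ s in 𝓝 r, HasDerivAt ψ (v s) s ∧
      HasDerivAt v (f (ψ s) + g (ψ s) * v s ^ q - (c - 1) / s * v s) s ∧ 0 < v s := by
  -- Here α = (u, r) as functions of t = φ, with du/dt = f(t)/u + g(t) u^(q-1) - (c-1)/r and dr/dt =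
  -- 1/u. The merely continuous f and g become coefficients in t, so no Lipschitz condition on them
  -- is needed.
  obtain ⟨α, hα0, hα⟩ := exists_hasDerivAt_smul_add (E := ℝ × ℝ) hf hg
    (A := fun x => (x.1⁻¹, 0)) (B := fun x => (x.1 ^ (q - 1), 0))
    (C := fun x => (-((c - 1) * x.2⁻¹), x.1⁻¹)) (x := (β, r))
    ((contDiffAt_fst.inv hβ.ne').prodMk contDiffAt_const)
    ((contDiffAt_fst.rpow_const_of_ne hβ.ne').prodMk contDiffAt_const)
    (((contDiffAt_const.mul (contDiffAt_snd.inv hr.ne')).neg).prodMk (contDiffAt_fst.inv hβ.ne')) b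
  have hα1 : ∀ᶠ t in 𝓝 b, HasDerivAt (fun t => (α t).1)
      (f t * (α t).1⁻¹ + g t * (α t).1 ^ (q - 1) + -((c - 1) * (α t).2⁻¹)) t := by
    filter_upwards [hα] with t ht
    exact ((ContinuousLinearMap.fst ℝ ℝ ℝ).hasFDerivAt.comp_hasDerivAt t ht).congr_deriv (by simp)
  have hα2 : ∀ᶠ t in 𝓝 b, HasDerivAt (fun t => (α t).2) (α t).1⁻¹ t := by
    filter_upwards [hα] with t ht
    exact ((ContinuousLinearMap.snd ℝ ℝ ℝ).hasFDerivAt.comp_hasDerivAt t ht).congr_deriv (by simp)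
  have hc1 : ContinuousAt (fun t => (α t).1) b := hα1.self_of_nhds.continuousAt
  have hb1 : (α b).1 = β := by rw [hα0]
  have hb2 : (α b).2 = r := by rw [hα0]
  have hpos : ∀ᶠ t in 𝓝 b, 0 < (α t).1 :=
    hc1.eventually (lt_mem_nhds (hβ.trans_eq hb1.symm))
  have hstrict : HasStrictDerivAt (fun t => (α t).2) (α b).1⁻¹ b :=
    hasStrictDerivAt_of_hasDerivAt_of_continuousAt hα2 (hc1.inv₀ (by rw [hb1]; exact hβ.ne'))
  have hne : (α b).1⁻¹ ≠ 0 := by rw [hb1]; exact (inv_pos.2 hβ).ne'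
  have hsf := hstrict.hasStrictFDerivAt_equiv hne
  -- Since dr/dt = 1/u is nonzero, r(t) is locally invertible, and its inverse is the solution φ as
  -- a function of r.
  set e := hsf.toOpenPartialHomeomorph (fun t => (α t).2) with he
  have hmem : b ∈ e.source := hsf.mem_toOpenPartialHomeomorph_source
  have heb : e b = r := hb2
  have hrt : r ∈ e.target := heb ▸ e.map_source hmem
  have hsr : e.symm r = b := by rw [← heb, e.left_inv hmem]
  have hcs : Tendsto e.symm (𝓝 r) (𝓝 b) := by
    have := (e.continuousAt_symm hrt).tendsto
    rwa [hsr] at this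
  have hψ : ∀ᶠ s in 𝓝 r, HasDerivAt e.symm (α (e.symm s)).1 s := by
    filter_upwards [hcs.eventually hpos, hcs.eventually hα2, e.open_target.mem_nhds hrt]
      with s h1 h2 h3
    simpa using e.hasDerivAt_symm h3 (inv_pos.2 h1).ne' h2
  refine ⟨e.symm, fun s => (α (e.symm s)).1, hsr, by simp only [hsr, hb1], ?_⟩
  filter_upwards [hψ, hcs.eventually hpos, hcs.eventually hα1, e.open_target.mem_nhds hrt]
    with s h1 h2 h3 h4
  refine ⟨h1, (h3.comp s h1).congr_deriv ?_, h2⟩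
  have h5 : (α (e.symm s)).2 = s := e.right_inv h4
  rw [h5, Real.rpow_sub_one h2.ne']
  field_simp
  ring

/-- Gluing at r: the left derivative is the limit of h', the right one comes from k, and the two
agree. It is applied to the solution and again to its derivative. -/
theorem hasDerivAt_ite_lt {h k h' k' : ℝ → ℝ} {x r : ℝ} (hx : x < r)
    (hh : ∀ s ∈ Set.Ioo x r, HasDerivAt h (h' s) s) (hlim : Tendsto h (𝓝[<] r) (𝓝 (k r)))
    (hlim' : Tendsto h' (𝓝[<] r) (𝓝 (k' r))) (hk : HasDerivAt k (k' r) r) :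
    HasDerivAt (fun s => if s < r then h s else k s) (k' r) r := by
  have hev : ∀ s ∈ Set.Ioo x r, (fun s => if s < r then h s else k s) =ᶠ[𝓝 s] h := by
    intro s hs
    filter_upwards [gt_mem_nhds hs.2] with y hy
    exact if_pos hy
  have hd : ∀ s ∈ Set.Ioo x r, HasDerivAt (fun s => if s < r then h s else k s) (h' s) s :=
    fun s hs => (hh s hs).congr_of_eventuallyEq (hev s hs)
  have hmem : Set.Ioo x r ∈ 𝓝[<] r := Ioo_mem_nhdsLT hx
  have hl : HasDerivWithinAt (fun s => if s < r then h s else k s) (k' r) (Set.Iic r) r := by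
    refine hasDerivWithinAt_Iic_of_tendsto_deriv (s := Set.Ioo x r)
      (fun s hs => (hd s hs).differentiableAt.differentiableWithinAt) ?_ hmem ?_
    · have : ContinuousWithinAt (fun s => if s < r then h s else k s) (Set.Iio r) r := by
        unfold ContinuousWithinAt
        simp only [lt_irrefl, if_false]
        refine hlim.congr' ?_
        filter_upwards [self_mem_nhdsWithin] with y hy
        exact (if_pos hy).symm
      exact this.mono fun s hs => hs.2
    · refine hlim'.congr' ?_
      filter_upwards [hmem] with y hy
      exact (hd y hy).deriv.symm
  have hr : HasDerivWithinAt (fun s => if s < r then h s else k s) (k' r) (Set.Ici r) r :=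
    hk.hasDerivWithinAt.congr (fun s hs => if_neg (not_lt.2 hs)) (if_neg (lt_irrefl r))
  have := hl.union hr
  rw [Set.Iic_union_Ici] at this
  exact this.hasDerivAt univ_mem

theorem exists_tendsto_nhdsLT_of_monotoneOn {h : ℝ → ℝ} {x r M : ℝ} (hx : x < r)
    (hm : MonotoneOn h (Set.Ico x r)) (hM : ∀ s ∈ Set.Ico x r, h s ≤ M) :
    ∃ b, Tendsto h (𝓝[<] r) (𝓝 b) := by
  have h1 : MonotoneOn (fun s => h (max s x)) (Set.Iio r) := fun s hs t ht hst =>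
    hm ⟨le_max_right _ _, max_lt hs hx⟩ ⟨le_max_right _ _, max_lt ht hx⟩ (max_le_max_right x hst)
  have h2 := h1.tendsto_nhdsLT (x := r) ⟨M, by
    rintro _ ⟨s, hs, rfl⟩
    exact hM _ ⟨le_max_right _ _, max_lt hs hx⟩⟩
  refine ⟨_, h2.congr' ?_⟩
  filter_upwards [Ioo_mem_nhdsLT hx] with s hs
  rw [max_eq_left hs.1.le]

/-- A radial solution on a bounded interval that has left limits, with positive limit of the
derivative, can be extended. -/
theorem IsRadialSolution.exists_extension {f g φ : ℝ → ℝ} {c q a R : ℝ}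
    (h : IsRadialSolution f g c q a R φ) (hf : Continuous f) (hfpos : ∀ t, 0 < f t)
    (hg : Continuous g) (hq : 0 < q) (hc : 1 ≤ c) {b β : ℝ} (hβ : 0 < β)
    (hb : Tendsto φ (𝓝[<] R) (𝓝 b)) (hβl : Tendsto (deriv φ) (𝓝[<] R) (𝓝 β)) :
    ∃ (R' : EReal) (ψ : ℝ → ℝ), (R : EReal) < R' ∧ IsRadialSolution f g c q a R' ψ ∧
      Set.EqOn ψ φ {r : ℝ | 0 ≤ r ∧ (r : EReal) < R} := by
  have hR : 0 < R := by exact_mod_cast h.pos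
  have hfl := h.isRadialFlow hf hfpos hg hq hc
  obtain ⟨ψ, v, hψ, hv, hev⟩ := exists_radial_extension hf hg c q (b := b) hR hβ
  obtain ⟨ε, hε, hε'⟩ := Metric.eventually_nhds_iff.1 hev
  set Ψ : ℝ → ℝ := fun s => if s < R then φ s else ψ s with hΨ
  set V : ℝ → ℝ := fun s => if s < R then deriv φ s else v s with hV
  set F : ℝ → ℝ := fun s => f (Ψ s) + g (Ψ s) * V s ^ q - (c - 1) / s * V s with hF
  have hlt : ∀ s : ℝ, s < R → Ψ =ᶠ[𝓝 s] φ ∧ V =ᶠ[𝓝 s] deriv φ := by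
    intro s hs
    constructor <;> filter_upwards [gt_mem_nhds hs] with y hy <;> exact if_pos hy
  have hd : ∀ s, 0 < s → s < R + ε → HasDerivAt Ψ (V s) s ∧ HasDerivAt V (F s) s ∧ 0 < V s := by
    intro s hs hsR
    rcases lt_trichotomy s R with hlt' | rfl | hgt
    · have e1 : Ψ s = φ s := if_pos hlt'
      have e2 : V s = deriv φ s := if_pos hlt'
      simp only [hF, e1, e2]
      have hsR' : (s : EReal) < R := EReal.coe_lt_coe_iff.2 hlt'
      exact ⟨(hfl.hasDerivAt_fst s hs hsR').congr_of_eventuallyEq (hlt s hlt').1,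
        (hfl.hasDerivAt_snd s hs hsR').congr_of_eventuallyEq (hlt s hlt').2, hfl.pos s hs hsR'⟩
    · have e1 : Ψ s = ψ s := if_neg (lt_irrefl _)
      have e2 : V s = v s := if_neg (lt_irrefl _)
      obtain ⟨h1, h2, h3⟩ := hε' (y := s) (by simpa using hε)
      simp only [hF, e1, e2]
      refine ⟨hasDerivAt_ite_lt hs
        (fun y hy => hfl.hasDerivAt_fst y hy.1 (EReal.coe_lt_coe_iff.2 hy.2))
        (by rw [hψ]; exact hb) (by rw [hv]; exact hβl) h1, ?_, h3⟩
      -- Only the value of `k'` at the gluing point matters, so a constant function serves.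
      refine hasDerivAt_ite_lt
        (k' := fun _ => f (ψ s) + g (ψ s) * v s ^ q - (c - 1) / s * v s) hs
        (fun y hy => hfl.hasDerivAt_snd y hy.1 (EReal.coe_lt_coe_iff.2 hy.2))
        (by rw [hv]; exact hβl) ?_ h2
      simp only [hψ, hv]
      have t1 := (hf.tendsto b).comp hb
      have t2 := (hg.tendsto b).comp hb
      have t3 := hβl.rpow_const (p := q) (Or.inl hβ.ne')
      have t4 : Tendsto (fun y : ℝ => (c - 1) / y) (𝓝[<] s) (𝓝 ((c - 1) / s)) :=
        (tendsto_const_nhds.div tendsto_id hs.ne').mono_left nhdsWithin_le_nhds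
      exact (t1.add (t2.mul t3)).sub (t4.mul hβl)
    · have e1 : Ψ s = ψ s := if_neg (not_lt.2 hgt.le)
      have e2 : V s = v s := if_neg (not_lt.2 hgt.le)
      obtain ⟨h1, h2, h3⟩ := hε' (y := s) (by
        rw [Real.dist_eq, abs_of_pos (by linarith)]; linarith)
      simp only [hF, e1, e2]
      refine ⟨h1.congr_of_eventuallyEq ?_, h2.congr_of_eventuallyEq ?_, h3⟩ <;>
        filter_upwards [lt_mem_nhds hgt] with y hy <;> exact if_neg (not_lt.2 (le_of_lt hy))
  have hmem : ∀ s : ℝ, (s : EReal) < ((R + ε : ℝ) : EReal) → s < R + ε := fun s hs =>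
    EReal.coe_lt_coe_iff.1 hs
  have hO := isOpen_setOf_pos_and_coe_lt ((R + ε : ℝ) : EReal)
  have hderiv : Set.EqOn (deriv Ψ) V {r : ℝ | 0 < r ∧ (r : EReal) < ((R + ε : ℝ) : EReal)} :=
    fun s hs => (hd s hs.1 (hmem s hs.2)).1.deriv
  have hderiv2 : Set.EqOn (deriv V) F {r : ℝ | 0 < r ∧ (r : EReal) < ((R + ε : ℝ) : EReal)} :=
    fun s hs => (hd s hs.1 (hmem s hs.2)).2.1.deriv
  have hdd : ∀ s : ℝ, 0 < s → s < R + ε → deriv (deriv Ψ) s = F s := by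
    intro s hs hsR
    have hs' : s ∈ {r : ℝ | 0 < r ∧ (r : EReal) < ((R + ε : ℝ) : EReal)} :=
      ⟨hs, EReal.coe_lt_coe_iff.2 hsR⟩
    rw [(hderiv.eventuallyEq_of_mem (hO.mem_nhds hs')).deriv_eq]
    exact hderiv2 hs'
  have hsmall : ∀ᶠ s in 𝓝[>] (0 : ℝ), s < R := by
    filter_upwards [Ioo_mem_nhdsGT hR] with s hs using hs.2
  refine ⟨((R + ε : ℝ) : EReal), Ψ, EReal.coe_lt_coe_iff.2 (by linarith), ?_, ?_⟩
  · refine ⟨EReal.coe_pos.2 (by linarith), ?_, ?_, ?_, ?_, ?_, ?_, ?_⟩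
    · have hFc : ContinuousOn F {r : ℝ | 0 < r ∧ (r : EReal) < ((R + ε : ℝ) : EReal)} := by
        intro s hs
        obtain ⟨h1, h2, h3⟩ := hd s hs.1 (hmem s hs.2)
        have c1 := h1.continuousAt
        have c2 := h2.continuousAt
        exact (((hf.continuousAt.comp c1).add ((hg.continuousAt.comp c1).mul
          (c2.rpow_const (Or.inl h3.ne')))).sub
          ((continuousAt_const.div continuousAt_id hs.1.ne').mul c2)).continuousWithinAt
      have hV1 : ContDiffOn ℝ 1 V {r : ℝ | 0 < r ∧ (r : EReal) < ((R + ε : ℝ) : EReal)} := by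
        have := (contDiffOn_succ_iff_deriv_of_isOpen (n := 0) (f := V) (𝕜 := ℝ) hO).2
          ⟨fun s hs => (hd s hs.1 (hmem s hs.2)).2.1.differentiableAt.differentiableWithinAt,
            by simp, contDiffOn_zero.2 (hFc.congr hderiv2)⟩
        simpa using this
      have := (contDiffOn_succ_iff_deriv_of_isOpen (n := 1) (f := Ψ) (𝕜 := ℝ) hO).2
          ⟨fun s hs => (hd s hs.1 (hmem s hs.2)).1.differentiableAt.differentiableWithinAt,
            by simp, hV1.congr hderiv⟩
      simpa [one_add_one_eq_two] using this
    · intro s hs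
      rcases hs.1.eq_or_lt with rfl | hs0
      · have h1 := h.continuousOn 0 ⟨le_rfl, h.pos⟩
        refine ContinuousWithinAt.congr_of_eventuallyEq ?_
          ((hlt 0 hR).1.filter_mono nhdsWithin_le_nhds) (if_pos hR)
        refine (h.deriv_zero.continuousWithinAt).mono fun s hs => hs.1
      · exact (hd s hs0 (hmem s hs.2)).1.continuousAt.continuousWithinAt
    · exact (if_pos hR).trans h.map_zero
    · exact h.deriv_zero.congr_of_eventuallyEq ((hlt 0 hR).1.filter_mono nhdsWithin_le_nhds)
        (if_pos hR)
    · refine h.tendsto_deriv.congr' ?_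
      filter_upwards [hsmall] with s hs
      exact ((hlt s hs).1.deriv_eq).symm
    · obtain ⟨L, hL⟩ := h.tendsto_deriv_deriv
      refine ⟨L, hL.congr' ?_⟩
      filter_upwards [hsmall] with s hs
      exact ((hlt s hs).1.deriv.deriv_eq).symm
    · intro s hs hsR
      have hsR := hmem s hsR
      obtain ⟨h1, h2, h3⟩ := hd s hs hsR
      rw [hdd s hs hsR, h1.deriv, abs_of_pos h3]
      simp only [hF]
      ring
  · intro s hs
    exact if_pos (EReal.coe_lt_coe_iff.1 hs.2)

/-- A Nagumo argument: for q ≤ 2 and φ ≤ B one has u' ≤ K (1 + u²), so log(1 + u²) has derivative at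
most 2 K u = (2 K φ)'. Hence log(1 + u²) grows no faster than 2 K φ, which is bounded. -/
theorem IsRadialFlow.exists_snd_le {f g φ u : ℝ → ℝ} {c q a : ℝ} {R : EReal}
    (h : IsRadialFlow f g c q a R φ u) (hfm : Monotone f) (hfpos : ∀ t, 0 < f t)
    (hgm : Monotone g) (hq : 0 < q) (hq' : q ≤ 2) (hc : 1 ≤ c) {r₀ B : ℝ} (hr₀ : 0 < r₀)
    (hB : ∀ r : ℝ, r₀ ≤ r → (r : EReal) < R → φ r ≤ B) :
    ∃ M, ∀ r : ℝ, r₀ ≤ r → (r : EReal) < R → u r ≤ M := by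
  set K := f B + |g B| with hK
  have hK0 : 0 ≤ K := add_nonneg (hfpos B).le (abs_nonneg _)
  set N := Real.log (1 + u r₀ ^ 2) + 2 * K * (B - φ r₀) with hN
  refine ⟨Real.exp N, fun r hr hrR => ?_⟩
  have hd := le_of_hasDerivAt_nonneg
    (h := fun s => 2 * K * φ s - Real.log (1 + u s ^ 2))
    (h' := fun s => 2 * K * u s - (2 * u s * (f (φ s) + g (φ s) * u s ^ q -
      (c - 1) / s * u s)) / (1 + u s ^ 2)) hr (fun s hs => by
      have hsp := hr₀.trans_le hs.1
      have hsR := coe_lt_of_le hs.2 hrR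
      have h1 := ((h.hasDerivAt_snd s hsp hsR).pow 2).const_add 1
      have h2 := h1.log (show 1 + u s ^ 2 ≠ 0 by positivity)
      refine (((h.hasDerivAt_fst s hsp hsR).const_mul (2 * K)).sub h2).congr_deriv ?_
      simp)
    (fun s hs => by
      have hsp := hr₀.trans_le hs.1
      have hsR := coe_lt_of_le hs.2 hrR
      have hu := h.pos s hsp hsR
      have hφB := hB s hs.1 hsR
      have hden : 0 < 1 + u s ^ 2 := by positivity
      have e1 : u s ^ q ≤ 1 + u s ^ 2 := by
        rcases le_total (u s) 1 with hu1 | hu1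
        · have := Real.rpow_le_one hu.le hu1 hq.le
          have := sq_nonneg (u s)
          linarith
        · have := Real.rpow_le_rpow_of_exponent_le hu1 hq'
          rw [Real.rpow_two] at this
          linarith
      have e0 : 0 ≤ u s ^ q := Real.rpow_nonneg hu.le _
      have e2 : g (φ s) * u s ^ q ≤ |g B| * (1 + u s ^ 2) :=
        (mul_le_mul_of_nonneg_right ((hgm hφB).trans (le_abs_self _)) e0).trans
          (mul_le_mul_of_nonneg_left e1 (abs_nonneg _))
      have e3 : f (φ s) ≤ f B * (1 + u s ^ 2) := by
        have := hfm hφB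
        have := mul_nonneg (hfpos B).le (sq_nonneg (u s))
        linarith
      have e4 : 0 ≤ (c - 1) / s * u s := mul_nonneg (div_nonneg (by linarith) hsp.le) hu.le
      rw [sub_nonneg, div_le_iff₀ hden]
      have := mul_le_mul_of_nonneg_left
        (show f (φ s) + g (φ s) * u s ^ q - (c - 1) / s * u s ≤ K * (1 + u s ^ 2) by
          rw [hK]; linarith) (show 0 ≤ 2 * u s by linarith)
      linarith)
  have hφB := hB r hr hrR
  have hlog : Real.log (1 + u r ^ 2) ≤ N := by
    have := mul_le_mul_of_nonneg_left hφB (show 0 ≤ 2 * K by linarith)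
    rw [hN]
    linarith
  have h1 : 1 + u r ^ 2 ≤ Real.exp N := (Real.log_le_iff_le_exp (by positivity)).1 hlog
  nlinarith [sq_nonneg (u r - 1)]

/-- A maximal radial solution on a bounded interval is unbounded. -/
theorem IsMaximalRadialSolution.unbounded {f g φ : ℝ → ℝ} {c q a R : ℝ}
    (h : IsMaximalRadialSolution f g c q a R φ) (hf : Continuous f) (hfm : Monotone f)
    (hfpos : ∀ t, 0 < f t) (hg : Continuous g) (hgm : Monotone g) (hq : 0 < q) (hq' : q ≤ 2)
    (hc : 1 ≤ c) {r₀ : ℝ} (hr₀ : 0 < r₀) (hr₀R : r₀ < R) (B : ℝ) :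
    ∃ r ∈ Set.Ico r₀ R, B ≤ φ r := by
  by_contra! hB
  have hfl := h.1.isRadialFlow hf hfpos hg hq hc
  have hlt : ∀ {s : ℝ}, s < R → (s : EReal) < R := fun hs => EReal.coe_lt_coe_iff.2 hs
  obtain ⟨M, hM⟩ := hfl.exists_snd_le hfm hfpos hgm hq hq' hc hr₀
    (fun r hr hrR => (hB r ⟨hr, EReal.coe_lt_coe_iff.1 hrR⟩).le)
  obtain ⟨δ, hδ, hδu⟩ := hfl.exists_pos_le hfm hfpos hgm hq hc hr₀ (hlt hr₀R)
  obtain ⟨b, hb⟩ := exists_tendsto_nhdsLT_of_monotoneOn hr₀R (h := φ) (M := B)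
    (fun s hs t ht hst => hfl.mono (hr₀.trans_le hs.1) hst (hlt ht.2))
    (fun s hs => (hB s hs).le)
  have hM0 : 0 ≤ M := (hfl.pos r₀ hr₀ (hlt hr₀R)).le.trans (hM r₀ le_rfl (hlt hr₀R))
  -- The derivative u need not be monotone, but u' ≥ -K; so u + K s is monotone and bounded and has
  -- a left limit at R.
  set K := |g a| * M ^ q + (c - 1) / r₀ * M with hK
  have hK0 : 0 ≤ K := add_nonneg (mul_nonneg (abs_nonneg _) (Real.rpow_nonneg hM0 _))
    (mul_nonneg (div_nonneg (by linarith) hr₀.le) hM0)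
  obtain ⟨β, hβ⟩ := exists_tendsto_nhdsLT_of_monotoneOn hr₀R
    (h := fun s => deriv φ s + K * s) (M := M + K * R)
    (fun s hs t ht hst => by
      refine le_of_hasDerivAt_nonneg (h := fun s => deriv φ s + K * s) hst (fun x hx =>
        (hfl.hasDerivAt_snd x (hr₀.trans_le (hs.1.trans hx.1)) (hlt (hx.2.trans_lt ht.2))).add
          ((hasDerivAt_id x).const_mul K)) (fun x hx => ?_)
      have hxr : r₀ ≤ x := hs.1.trans hx.1
      have hxp := hr₀.trans_le hxr
      have hxR := hlt (hx.2.trans_lt ht.2)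
      have hu := hfl.pos x hxp hxR
      have huM := hM x hxr hxR
      have haφ := hfl.le_fst x hxp hxR
      have e0 : 0 ≤ deriv φ x ^ q := Real.rpow_nonneg hu.le _
      have e1 := mul_le_mul_of_nonneg_right (hgm haφ) e0
      have e2 := mul_le_mul_of_nonneg_right (neg_abs_le (g a)) e0
      have e3 := mul_le_mul_of_nonneg_left (Real.rpow_le_rpow hu.le huM hq.le) (abs_nonneg (g a))
      have e4 : (c - 1) / x * deriv φ x ≤ (c - 1) / r₀ * M :=
        mul_le_mul (div_le_div_of_nonneg_left (by linarith) hr₀ hxr) huM hu.le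
          (div_nonneg (by linarith) hr₀.le)
      have e5 := hfpos (φ x)
      linarith)
    (fun s hs => by
      have := hM s hs.1 (hlt hs.2)
      have := mul_le_mul_of_nonneg_left hs.2.le hK0
      linarith)
  have hβ' : Tendsto (deriv φ) (𝓝[<] R) (𝓝 (β - K * R)) := by
    have h1 : Tendsto (fun s : ℝ => K * s) (𝓝[<] R) (𝓝 (K * R)) :=
      (tendsto_id.const_mul K).mono_left nhdsWithin_le_nhds
    simpa using hβ.sub h1
  have hpos : 0 < β - K * R := hδ.trans_le (ge_of_tendsto hβ' (by
    filter_upwards [Ioo_mem_nhdsLT hr₀R] with s hs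
    exact hδu s hs.1.le (hlt hs.2)))
  exact h.2 (h.1.exists_extension hf hfpos hg hq hc hpos hb hβ')

/-! ### The case lim g > 0 -/

/-- If `1 / D` is integrable at infinity and `D` is nondecreasing, then `D` grows superlinearly. -/
theorem eventually_mul_le_of_lintegral_inv_ne_top {D : ℝ → ℝ} {t : ℝ} (ht : 0 < t)
    (hD : ContinuousOn D (Set.Ioi 0)) (hpos : ∀ s, t ≤ s → 0 < D s)
    (hmono : ∀ s x, t ≤ s → s ≤ x → D s ≤ D x)
    (hint : ∫⁻ s in Set.Ioi t, ENNReal.ofReal (1 / D s) ≠ ⊤) (K : ℝ) :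
    ∀ᶠ s in atTop, K * s ≤ D s := by
  have hwc : ContinuousOn (fun s => 1 / D s) (Set.Ici t) :=
    continuousOn_const.div (hD.mono fun s hs => ht.trans_le hs) fun s hs => (hpos s hs).ne'
  have hi : IntegrableOn (fun s => 1 / D s) (Set.Ioi t) := by
    refine ⟨(hwc.mono Set.Ioi_subset_Ici_self).aestronglyMeasurable measurableSet_Ioi, ?_⟩
    rw [hasFiniteIntegral_iff_norm]
    refine lt_of_le_of_lt (le_of_eq ?_) (lt_top_iff_ne_top.2 hint)
    refine setLIntegral_congr_fun measurableSet_Ioi fun s hs => ?_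
    simp only [Real.norm_eq_abs, abs_of_pos (one_div_pos.2 (hpos s (le_of_lt hs)))]
  -- By convergence, the integral of 1/D over [s/2, s] tends to 0, while monotonicity of D bounds it
  -- below by s / (2 D(s)).
  have hlim := intervalIntegral_tendsto_integral_Ioi t hi tendsto_id
  have hlim2 := intervalIntegral_tendsto_integral_Ioi t hi
    (tendsto_id.atTop_div_const (two_pos (α := ℝ)))
  have hlim3 := hlim.sub hlim2
  rw [sub_self] at hlim3
  have hK : 0 < 1 / (2 * (|K| + 1)) := by positivity
  filter_upwards [hlim3.eventually (gt_mem_nhds hK), eventually_ge_atTop (2 * t)] with s hs hst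
  have hs0 : 0 < s := by linarith
  have hii : ∀ x y, t ≤ x → x ≤ y → IntervalIntegrable (fun s => 1 / D s) volume x y :=
    fun x y hx hxy => ContinuousOn.intervalIntegrable (hwc.mono (by
      rw [Set.uIcc_of_le hxy]; intro z hz; exact hx.trans hz.1))
  have h1 : s / 2 * (1 / D s) ≤ ∫ x in (s / 2)..s, 1 / D x := by
    have := intervalIntegral.integral_mono_on (a := s / 2) (b := s) (by linarith)
      (intervalIntegrable_const (c := 1 / D s)) (hii (s / 2) s (by linarith) (by linarith))
      (fun x hx => one_div_le_one_div_of_le (hpos x (by linarith [hx.1]))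
        (hmono x s (by linarith [hx.1]) hx.2))
    rw [intervalIntegral.integral_const, smul_eq_mul] at this
    linarith
  have h2 : (∫ x in t..(s / 2), 1 / D x) + ∫ x in (s / 2)..s, 1 / D x = ∫ x in t..s, 1 / D x :=
    intervalIntegral.integral_add_adjacent_intervals (hii _ _ le_rfl (by linarith))
      (hii _ _ (by linarith) (by linarith))
  have h3 : s / 2 * (1 / D s) < 1 / (2 * (|K| + 1)) := by
    simp only [id] at hs
    linarith
  have hDs := hpos s (by linarith)
  rw [mul_one_div, div_div, div_lt_div_iff₀ (by positivity) (by positivity)] at h3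
  have h4 := mul_le_mul_of_nonneg_right (le_abs_self K) hs0.le
  linarith

/-- The denominator of the integrand in `GrowthConditionPos`. -/
noncomputable def posDenom (f g : ℝ → ℝ) (q t : ℝ) : ℝ :=
  (t * f t) ^ (1 / 2 : ℝ) + (t * (g t)⁺) ^ (1 / (2 - q))

section posDenom

variable {f g : ℝ → ℝ} {q : ℝ}

theorem continuous_posDenom (hf : Continuous f) (hg : Continuous g) (hq : q ≤ 1) :
    Continuous (posDenom f g q) := by
  have h1 : Continuous fun t => (t * f t) ^ (1 / 2 : ℝ) :=
    (continuous_id.mul hf).rpow_const fun _ => Or.inr (by norm_num)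
  have hg' : Continuous fun t => (g t)⁺ := hg.sup continuous_const
  have h2 : Continuous fun t => (t * (g t)⁺) ^ (1 / (2 - q)) :=
    (continuous_id.mul hg').rpow_const fun _ => Or.inr (one_div_nonneg.2 (by linarith))
  exact h1.add h2

theorem posDenom_pos (hfpos : ∀ t, 0 < f t) {t : ℝ} (ht : 0 < t) : 0 < posDenom f g q t :=
  add_pos_of_pos_of_nonneg (Real.rpow_pos_of_pos (mul_pos ht (hfpos t)) _)
    (Real.rpow_nonneg (mul_nonneg ht.le (posPart_nonneg _)) _)

theorem posDenom_mono (hfm : Monotone f) (hfpos : ∀ t, 0 < f t) (hgm : Monotone g) (hq : q ≤ 1)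
    {s t : ℝ} (hs : 0 ≤ s) (hst : s ≤ t) : posDenom f g q s ≤ posDenom f g q t := by
  refine add_le_add ?_ ?_
  · exact Real.rpow_le_rpow (mul_nonneg hs (hfpos s).le)
      (mul_le_mul hst (hfm hst) (hfpos s).le (hs.trans hst)) (by norm_num)
  · exact Real.rpow_le_rpow (mul_nonneg hs (posPart_nonneg _))
      (mul_le_mul hst (posPart_mono (hgm hst)) (posPart_nonneg _) (hs.trans hst))
      (one_div_nonneg.2 (by linarith))

theorem continuousOn_one_div_posDenom (hf : Continuous f) (hfpos : ∀ t, 0 < f t)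
    (hg : Continuous g) (hq : q ≤ 1) :
    ContinuousOn (fun t => 1 / posDenom f g q t) (Set.Ioi 0) :=
  continuousOn_const.div (continuous_posDenom hf hg hq).continuousOn
    fun _ ht => (posDenom_pos hfpos ht).ne'

theorem lintegral_posDenom_eq_top_iff (hfm : Monotone f) (hfpos : ∀ t, 0 < f t) {t : ℝ}
    (ht : 0 < t) :
    ∫⁻ s in Set.Ioi (0 : ℝ), ENNReal.ofReal (1 / posDenom f g q s) = ⊤ ↔
      ∫⁻ s in Set.Ioi t, ENNReal.ofReal (1 / posDenom f g q s) = ⊤ := by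
  refine lintegral_Ioi_eq_top_iff (K := 1 / f 0 ^ (1 / 2 : ℝ)) ht fun s hs => ?_
  have h0 : 0 < s ^ (1 / 2 : ℝ) * f 0 ^ (1 / 2 : ℝ) :=
    mul_pos (Real.rpow_pos_of_pos hs.1 _) (Real.rpow_pos_of_pos (hfpos 0) _)
  have h1 : s ^ (1 / 2 : ℝ) * f 0 ^ (1 / 2 : ℝ) ≤ posDenom f g q s := by
    rw [← Real.mul_rpow hs.1.le (hfpos 0).le]
    refine le_add_of_le_of_nonneg (Real.rpow_le_rpow (mul_nonneg hs.1.le (hfpos 0).le)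
      (mul_le_mul_of_nonneg_left (hfm hs.1.le) hs.1.le) (by norm_num))
      (Real.rpow_nonneg (mul_nonneg hs.1.le (posPart_nonneg _)) _)
  refine (one_div_le_one_div_of_le h0 h1).trans (le_of_eq ?_)
  rw [Real.rpow_neg hs.1.le]
  field_simp

end posDenom

namespace IsRadialFlow

variable {f g φ u : ℝ → ℝ} {c q a : ℝ} {R : EReal}

/-- An upper bound of the derivative by `posDenom`. -/
theorem exists_le_posDenom (h : IsRadialFlow f g c q a R φ u) (hfm : Monotone f)
    (hfpos : ∀ t, 0 < f t) (hgm : Monotone g) (hq : 0 < q) (hq1 : q ≤ 1) (hc : 1 ≤ c) {t r₁ : ℝ}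
    (ht : 0 < t) (hg0 : 0 ≤ g t) (hr₁ : 0 < r₁) (hφr₁ : t ≤ φ r₁) :
    ∃ C, 0 < C ∧ ∀ r : ℝ, r₁ ≤ r → (r : EReal) < R → u r ≤ C * posDenom f g q (φ r) := by
  -- The first term absorbs the initial energy through t f(t) ≤ T f(T); the 4 comes from doubling 2
  -- T f(T).
  set K := 2 * u r₁ ^ 2 / (t * f t) + 4 with hK
  have htf : 0 < t * f t := mul_pos ht (hfpos t)
  have hK0 : 0 < K := by positivity
  have hq2 : 0 < 2 - q := by linarith
  refine ⟨K ^ (1 / 2 : ℝ) + 4 ^ (1 / (2 - q)), by positivity, fun r hr hrR => ?_⟩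
  have hin : ∀ s ∈ Set.Icc r₁ r, 0 < s ∧ (s : EReal) < R := fun s hs =>
    ⟨hr₁.trans_le hs.1, coe_lt_of_le hs.2 hrR⟩
  -- The energy u² is integrated only up to the point where u is maximal, which yields the closed
  -- inequality m² ≤ u(r₁)² + 2 T f(T) + 2 T g(T) m^q for the maximum m.
  obtain ⟨x, hx, hxmax⟩ := isCompact_Icc.exists_isMaxOn (Set.nonempty_Icc.2 hr)
    (f := u) fun s hs =>
      (h.hasDerivAt_snd s (hin s hs).1 (hin s hs).2).continuousAt.continuousWithinAt
  set m := u x with hm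
  have hmax : ∀ s ∈ Set.Icc r₁ r, u s ≤ m := fun s hs => hxmax hs
  have hm0 : 0 < m := h.pos x (hin x hx).1 (hin x hx).2
  set T := φ r with hT
  have hφ1 : φ r₁ ≤ T := h.mono hr₁ hr hrR
  have htT : t ≤ T := hφr₁.trans hφ1
  have hgT : 0 ≤ g T := hg0.trans (hgm htT)
  have hT0 : 0 < T := ht.trans_le htT
  have hmq : 0 < m ^ q := Real.rpow_pos_of_pos hm0 _
  have hS0 : 0 ≤ f T + g T * m ^ q := add_nonneg (hfpos T).le (mul_nonneg hgT hmq.le)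
  have hen := le_of_hasDerivAt_nonneg
    (h := fun s => 2 * (f T + g T * m ^ q) * φ s - u s ^ 2)
    (h' := fun s => 2 * (f T + g T * m ^ q) * u s -
      2 * u s * (f (φ s) + g (φ s) * u s ^ q - (c - 1) / s * u s)) hx.1 (fun s hs => by
        have hs' := hin s ⟨hs.1, hs.2.trans hx.2⟩
        refine (((h.hasDerivAt_fst s hs'.1 hs'.2).const_mul _).sub
          ((h.hasDerivAt_snd s hs'.1 hs'.2).pow 2)).congr_deriv ?_
        simp) (fun s hs => by
        have hsI : s ∈ Set.Icc r₁ r := ⟨hs.1, hs.2.trans hx.2⟩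
        have hs' := hin s hsI
        have hu := h.pos s hs'.1 hs'.2
        have e0 : 0 ≤ u s ^ q := Real.rpow_nonneg hu.le _
        have e1 : u s ^ q ≤ m ^ q := Real.rpow_le_rpow hu.le (hmax s hsI) hq.le
        have e2 : φ s ≤ T := h.mono hs'.1 hsI.2 hrR
        have e3 := hfm e2
        have e4 : g (φ s) * u s ^ q ≤ g T * m ^ q :=
          (mul_le_mul_of_nonneg_right (hgm e2) e0).trans (mul_le_mul_of_nonneg_left e1 hgT)
        have e5 : 0 ≤ (c - 1) / s * u s := mul_nonneg (div_nonneg (by linarith) hs'.1.le) hu.le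
        have := mul_le_mul_of_nonneg_left (show f (φ s) + g (φ s) * u s ^ q - (c - 1) / s * u s ≤
          f T + g T * m ^ q by linarith) (show 0 ≤ 2 * u s by linarith)
        linarith)
  have hφx : φ x - φ r₁ ≤ T := by
    have : φ x ≤ T := h.mono (hin x hx).1 hx.2 hrR
    linarith
  have hen2 : m ^ 2 ≤ u r₁ ^ 2 + 2 * (T * f T) + 2 * (T * g T) * m ^ q := by
    have := mul_le_mul_of_nonneg_left hφx (show 0 ≤ 2 * (f T + g T * m ^ q) by linarith)
    linarith
  have hX0 : 0 ≤ (T * f T) ^ (1 / 2 : ℝ) := Real.rpow_nonneg (mul_pos hT0 (hfpos T)).le _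
  have hY0 : 0 ≤ (T * g T) ^ (1 / (2 - q)) := Real.rpow_nonneg (mul_nonneg hT0.le hgT) _
  have hDT : posDenom f g q T = (T * f T) ^ (1 / 2 : ℝ) + (T * g T) ^ (1 / (2 - q)) := by
    rw [posDenom, posPart_eq_self.2 hgT]
  have hA0 : 0 ≤ K ^ (1 / 2 : ℝ) := Real.rpow_nonneg hK0.le _
  have hB0 : (0 : ℝ) ≤ 4 ^ (1 / (2 - q)) := by positivity
  refine (hmax r ⟨hr, le_rfl⟩).trans ?_
  rw [hDT]
  -- One of the two parts of the right-hand side is at least m²/2: the source gives the first term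
  -- of the denominator, the gradient term gives the second.
  rcases le_total (m ^ 2 / 2) (u r₁ ^ 2 + 2 * (T * f T)) with hcase | hcase
  · have h1 : m ^ 2 ≤ K * (T * f T) := by
      have e1 : t * f t ≤ T * f T := mul_le_mul htT (hfm htT) (hfpos t).le hT0.le
      have e2 : 2 * u r₁ ^ 2 = 2 * u r₁ ^ 2 / (t * f t) * (t * f t) :=
        (div_mul_cancel₀ _ htf.ne').symm
      have e3 := mul_le_mul_of_nonneg_left e1
        (show 0 ≤ 2 * u r₁ ^ 2 / (t * f t) by positivity)
      rw [hK]
      linarith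
    have h2 : m ≤ K ^ (1 / 2 : ℝ) * (T * f T) ^ (1 / 2 : ℝ) := by
      rw [← Real.mul_rpow hK0.le (mul_pos hT0 (hfpos T)).le, ← Real.sqrt_eq_rpow]
      exact Real.le_sqrt_of_sq_le h1
    have := mul_nonneg hA0 hY0
    have := mul_nonneg hB0 hX0
    have := mul_nonneg hB0 hY0
    linarith
  · have h1 : m ^ 2 ≤ 4 * (T * g T) * m ^ q := by linarith
    have h2 : m ^ (2 - q) ≤ 4 * (T * g T) := by
      rw [Real.rpow_sub hm0, Real.rpow_two, div_le_iff₀ hmq]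
      exact h1
    have h3 : m ≤ 4 ^ (1 / (2 - q)) * (T * g T) ^ (1 / (2 - q)) := by
      rw [← Real.mul_rpow (by norm_num) (mul_nonneg hT0.le hgT)]
      have := Real.rpow_le_rpow (Real.rpow_nonneg hm0.le _) h2
        (one_div_nonneg.2 hq2.le)
      rwa [← Real.rpow_mul hm0.le, mul_one_div_cancel hq2.ne', Real.rpow_one] at this
    have := mul_nonneg hA0 hX0
    have := mul_nonneg hA0 hY0
    have := mul_nonneg hB0 hX0
    linarith

end IsRadialFlow

/-- The radial damping is absorbed by the right-hand side where `posDenom` is superlinear. -/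
theorem mul_le_half_of_le_posDenom {f g : ℝ → ℝ} {q C K L t p : ℝ} (hfpos : ∀ t, 0 < f t)
    (hq1 : q ≤ 1) (ht : 0 < t) (hgt : 0 ≤ g t) (hp : 0 < p) (hC : 0 < C) (hK : 0 ≤ K)
    (hpD : p ≤ C * posDenom f g q t) (hL : 8 * C * K ≤ L) (hL' : 4 * K * (2 * C) ^ (1 - q) ≤ L)
    (hLD : L * t ≤ posDenom f g q t) :
    K * p ≤ (f t + g t * p ^ q) / 2 := by
  have hq2 : 0 < 2 - q := by linarith
  rw [posDenom, posPart_eq_self.2 hgt] at hpD hLD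
  set X := (t * f t) ^ (1 / 2 : ℝ) with hX
  set Y := (t * g t) ^ (1 / (2 - q)) with hY
  have hX0 : 0 ≤ X := Real.rpow_nonneg (mul_pos ht (hfpos t)).le _
  have hY0 : 0 ≤ Y := Real.rpow_nonneg (mul_nonneg ht.le hgt) _
  have hpq : 0 < p ^ q := Real.rpow_pos_of_pos hp _
  have hgp : 0 ≤ g t * p ^ q := mul_nonneg hgt hpq.le
  have hL0 : 0 ≤ L := le_trans (by positivity) hL
  -- The larger of X, Y is at least L t / 2. Combined with X² = t f, this gives L X ≤ 2 f; combined
  -- with Y^(2-q) = t g, it gives L Y^(1-q) ≤ 2 g. Either way K p is absorbed by the corresponding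
  -- term.
  rcases le_total Y X with hYX | hXY
  · have hX2 : X * X = t * f t := by
      rw [hX, ← Real.sqrt_eq_rpow, Real.mul_self_sqrt (mul_pos ht (hfpos t)).le]
    have h1 : p ≤ 2 * C * X := by
      have := mul_le_mul_of_nonneg_left hYX hC.le
      linarith
    have h2 : L * X ≤ 2 * f t := by
      have e1 : L * t ≤ 2 * X := by linarith
      have e2 := mul_le_mul_of_nonneg_right e1 hX0
      have e3 : t * (L * X) ≤ t * (2 * f t) := by linarith
      exact le_of_mul_le_mul_left e3 ht
    have h3 := mul_le_mul_of_nonneg_left h1 hK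
    have h4 := mul_le_mul_of_nonneg_right hL hX0
    linarith
  · have h1 : p ≤ 2 * C * Y := by
      have := mul_le_mul_of_nonneg_left hXY hC.le
      linarith
    have hYp : 0 < Y := by
      rcases hY0.eq_or_lt with h0 | h0
      · rw [← h0, mul_zero] at h1
        linarith
      · exact h0
    have hY2 : Y ^ (1 - q) * Y = t * g t := by
      rw [← Real.rpow_add_one hYp.ne', hY, ← Real.rpow_mul (mul_nonneg ht.le hgt)]
      rw [show 1 / (2 - q) * (1 - q + 1) = 1 by field_simp; ring, Real.rpow_one]
    have hYq : 0 < Y ^ (1 - q) := Real.rpow_pos_of_pos hYp _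
    have h2 : L * Y ^ (1 - q) ≤ 2 * g t := by
      have e1 : L * t ≤ 2 * Y := by linarith
      have e2 := mul_le_mul_of_nonneg_right e1 hYq.le
      have e3 : t * (L * Y ^ (1 - q)) ≤ t * (2 * g t) := by linarith
      exact le_of_mul_le_mul_left e3 ht
    have h3 : p ^ (1 - q) ≤ (2 * C) ^ (1 - q) * Y ^ (1 - q) := by
      rw [← Real.mul_rpow (by positivity) hY0]
      exact Real.rpow_le_rpow hp.le h1 (by linarith)
    have h4 : 2 * K * p ^ (1 - q) ≤ g t := by
      have e1 := mul_le_mul_of_nonneg_left h3 (show 0 ≤ 4 * K by linarith)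
      have e2 := mul_le_mul_of_nonneg_right hL' hYq.le
      linarith
    have h5 : p ^ (1 - q) * p ^ q = p := by
      rw [← Real.rpow_add hp, sub_add_cancel, Real.rpow_one]
    have h6 := mul_le_mul_of_nonneg_right h4 hpq.le
    have h7 : 2 * K * p ^ (1 - q) * p ^ q = 2 * K * p := by rw [mul_assoc, h5]
    have := hfpos t
    linarith

namespace IsRadialFlow

variable {f g φ u : ℝ → ℝ} {c q a : ℝ} {R : EReal}

/-- A lower bound of the derivative by `posDenom` where the damping is absorbed. -/
theorem posDenom_half_le (h : IsRadialFlow f g c q a ⊤ φ u) (hfm : Monotone f)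
    (hfpos : ∀ t, 0 < f t) (hgm : Monotone g) (hq1 : q ≤ 1) {t r₂ r : ℝ}
    (ht : 0 < t) (hg0 : 0 ≤ g t) (hr₂ : 0 < r₂) (hφr₂ : t ≤ φ r₂)
    (hdamp : ∀ s, r₂ ≤ s → (c - 1) / s * u s ≤ (f (φ s) + g (φ s) * u s ^ q) / 2)
    (hr : r₂ ≤ r) (hφr : 2 * φ r₂ ≤ φ r) :
    posDenom f g q (φ r / 2) ≤ 3 * u r := by
  have hq2 : 0 < 2 - q := by linarith
  have hcont : ContinuousOn φ (Set.Icc r₂ r) := fun s hs =>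
    (h.hasDerivAt_fst s (hr₂.trans_le hs.1) (EReal.coe_lt_top s)).continuousAt.continuousWithinAt
  -- From s, where φ = T = φ(r)/2, to r, φ gains T while f(φ) ≥ f(T) and g(φ) ≥ g(T). Integrating u²
  -- and u^(2-q) over [s, r] bounds the two terms of the denominator at T by u(r) and 2 u(r), whence
  -- the constant 3.
  obtain ⟨s, hs, hsφ⟩ := intermediate_value_Icc hr hcont
    (show φ r / 2 ∈ Set.Icc (φ r₂) (φ r) by constructor <;> linarith)
  set T := φ r / 2 with hT
  have htT : t ≤ T := by linarith
  have hT0 : 0 < T := ht.trans_le htT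
  have hgT : 0 ≤ g T := hg0.trans (hgm htT)
  have hsp : 0 < s := hr₂.trans_le hs.1
  have hin : ∀ x ∈ Set.Icc s r, 0 < x ∧ T ≤ φ x ∧ 0 < u x ∧
      (f (φ x) + g (φ x) * u x ^ q) / 2 ≤
        f (φ x) + g (φ x) * u x ^ q - (c - 1) / x * u x := fun x hx => by
    have hx0 := hsp.trans_le hx.1
    have := hdamp x (hs.1.trans hx.1)
    exact ⟨hx0, hsφ ▸ h.mono hsp hx.1 (EReal.coe_lt_top x), h.pos x hx0 (EReal.coe_lt_top x),
      by linarith⟩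
  have hur := (hin r ⟨hs.2, le_rfl⟩).2.2.1
  have hus := (hin s ⟨le_rfl, hs.2⟩).2.2.1
  have h1 : T * f T ≤ u r ^ 2 := by
    have := le_of_hasDerivAt_nonneg (h := fun x => u x ^ 2 - f T * φ x)
      (h' := fun x => 2 * u x * (f (φ x) + g (φ x) * u x ^ q - (c - 1) / x * u x) - f T * u x)
      hs.2 (fun x hx => by
        refine (((h.hasDerivAt_snd x (hin x hx).1 (EReal.coe_lt_top x)).pow 2).sub
          ((h.hasDerivAt_fst x (hin x hx).1 (EReal.coe_lt_top x)).const_mul _)).congr_deriv ?_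
        simp) (fun x hx => by
        obtain ⟨-, e1, e2, e3⟩ := hin x hx
        have e4 : 0 ≤ g (φ x) * u x ^ q :=
          mul_nonneg (hgT.trans (hgm e1)) (Real.rpow_nonneg e2.le _)
        have e5 := mul_le_mul_of_nonneg_left (show f T / 2 ≤
          f (φ x) + g (φ x) * u x ^ q - (c - 1) / x * u x by
            have := hfm e1
            linarith) (show 0 ≤ 2 * u x by linarith)
        linarith)
    have e := sq_nonneg (u s)
    rw [hsφ] at this
    have hφT : φ r = 2 * T := by rw [hT]; ring
    rw [hφT] at this
    linarith
  have h2 : T * g T / 2 ≤ u r ^ (2 - q) := by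
    have := le_of_hasDerivAt_nonneg (h := fun x => u x ^ (2 - q) - g T / 2 * φ x)
      (h' := fun x => (f (φ x) + g (φ x) * u x ^ q - (c - 1) / x * u x) * (2 - q) *
        u x ^ (2 - q - 1) - g T / 2 * u x)
      hs.2 (fun x hx =>
        ((h.hasDerivAt_snd x (hin x hx).1 (EReal.coe_lt_top x)).rpow_const
          (Or.inl (hin x hx).2.2.1.ne')).sub
          ((h.hasDerivAt_fst x (hin x hx).1 (EReal.coe_lt_top x)).const_mul _)) (fun x hx => by
        obtain ⟨-, e1, e2, e3⟩ := hin x hx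
        have e4 : 0 < u x ^ q := Real.rpow_pos_of_pos e2 _
        have e5 : 0 < u x ^ (2 - q - 1) := Real.rpow_pos_of_pos e2 _
        have e6 : u x ^ q * u x ^ (2 - q - 1) = u x := by
          rw [← Real.rpow_add e2, show q + (2 - q - 1) = 1 by ring, Real.rpow_one]
        have e7 := mul_le_mul_of_nonneg_right (hgm e1) e4.le
        have e8 : g T / 2 * u x ^ q ≤ f (φ x) + g (φ x) * u x ^ q - (c - 1) / x * u x := by
          have := hfpos (φ x)
          linarith
        have e9 : 0 ≤ f (φ x) + g (φ x) * u x ^ q - (c - 1) / x * u x :=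
          le_trans (mul_nonneg (by linarith) e4.le) e8
        have e10 : g T / 2 * u x ^ q ≤
            (f (φ x) + g (φ x) * u x ^ q - (c - 1) / x * u x) * (2 - q) := by
          have := mul_nonneg e9 (show 0 ≤ 1 - q by linarith)
          linarith
        have e11 := mul_le_mul_of_nonneg_right e10 e5.le
        have e12 : g T / 2 * u x ^ q * u x ^ (2 - q - 1) = g T / 2 * u x := by
          rw [mul_assoc, e6]
        linarith)
    have e : 0 ≤ u s ^ (2 - q) := Real.rpow_nonneg hus.le _
    simp only [hsφ] at this
    have hφT : φ r = 2 * T := by rw [hT]; ring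
    rw [hφT] at this
    linarith
  rw [posDenom, posPart_eq_self.2 hgT]
  have h3 : (T * f T) ^ (1 / 2 : ℝ) ≤ u r := by
    rw [← Real.sqrt_eq_rpow]
    exact (Real.sqrt_le_left hur.le).2 h1
  have h4 : (T * g T) ^ (1 / (2 - q)) ≤ 2 * u r := by
    have e1 : T * g T ≤ (2 * u r) ^ (2 - q) := by
      rw [Real.mul_rpow (by norm_num) hur.le]
      have e2 : (2 : ℝ) ≤ 2 ^ (2 - q) := by
        have := Real.rpow_le_rpow_of_exponent_le (show (1 : ℝ) ≤ 2 by norm_num)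
          (show 1 ≤ 2 - q by linarith)
        rwa [Real.rpow_one] at this
      have e3 := mul_le_mul_of_nonneg_right e2 (Real.rpow_nonneg hur.le (2 - q))
      linarith
    have := Real.rpow_le_rpow (mul_nonneg hT0.le hgT) e1 (one_div_nonneg.2 hq2.le)
    rwa [← Real.rpow_mul (by linarith), mul_one_div_cancel hq2.ne', Real.rpow_one] at this
  linarith

/-- Convergence would make the denominator superlinear, so the damping would use at most half of the
right-hand side. The resulting lower bound on u then forces divergence, a contradiction. -/
theorem lintegral_posDenom_eq_top (h : IsRadialFlow f g c q a ⊤ φ u) (hf : Continuous f)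
    (hfm : Monotone f) (hfpos : ∀ t, 0 < f t) (hg : Continuous g) (hgm : Monotone g)
    (hq : 0 < q) (hq1 : q ≤ 1) (hc : 1 ≤ c) {t : ℝ} (ht : 0 < t) (hg0 : 0 ≤ g t) :
    ∫⁻ s in Set.Ioi t, ENNReal.ofReal (1 / posDenom f g q s) = ⊤ := by
  by_contra hne
  have hφ := h.tendsto_atTop hfm hfpos hgm hq hc
  obtain ⟨r₁, hφ1, hr₁⟩ := ((hφ.eventually_ge_atTop t).and (eventually_ge_atTop 1)).exists
  have hr₁0 : 0 < r₁ := zero_lt_one.trans_le hr₁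
  obtain ⟨C, hC, hCu⟩ := h.exists_le_posDenom hfm hfpos hgm hq hq1 hc ht hg0 hr₁0 hφ1
  set K := c - 1 with hK
  have hK0 : 0 ≤ K := by linarith
  set L := max (8 * C * K) (4 * K * (2 * C) ^ (1 - q)) with hL
  have hLD := eventually_mul_le_of_lintegral_inv_ne_top ht
    (continuous_posDenom hf hg hq1).continuousOn
    (fun s hs => posDenom_pos hfpos (ht.trans_le hs))
    (fun s x hs hsx => posDenom_mono hfm hfpos hgm hq1 (ht.le.trans hs) hsx) hne L
  obtain ⟨t₂, ht₂⟩ := eventually_atTop.1 hLD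
  obtain ⟨r₂, hφ2, hr₂⟩ := ((hφ.eventually_ge_atTop (max t t₂)).and
    (eventually_ge_atTop r₁)).exists
  have hr₂0 : 0 < r₂ := hr₁0.trans_le hr₂
  have hdamp : ∀ s, r₂ ≤ s → (c - 1) / s * u s ≤ (f (φ s) + g (φ s) * u s ^ q) / 2 := by
    intro s hs
    have hs0 := hr₂0.trans_le hs
    have hu := h.pos s hs0 (EReal.coe_lt_top s)
    have hφs : max t t₂ ≤ φ s := hφ2.trans (h.mono hr₂0 hs (EReal.coe_lt_top s))
    have htφ : t ≤ φ s := (le_max_left _ _).trans hφs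
    have := mul_le_half_of_le_posDenom (K := K) hfpos hq1 (ht.trans_le htφ)
      (hg0.trans (hgm htφ)) hu hC hK0 (hCu s (hr₂.trans hs) (EReal.coe_lt_top s))
      (le_max_left _ _) (le_max_right _ _) (ht₂ _ ((le_max_right _ _).trans hφs))
    refine le_trans (mul_le_mul_of_nonneg_right ?_ hu.le) this
    exact div_le_self hK0 (hr₁.trans (hr₂.trans hs))
  obtain ⟨r₃, hφ3, hr₃⟩ := ((hφ.eventually_ge_atTop (max (2 * t) (2 * φ r₂))).and
    (eventually_ge_atTop r₂)).exists
  have hin : ∀ s, r₃ ≤ s → 0 < s ∧ 2 * t ≤ φ s ∧ 2 * φ r₂ ≤ φ s ∧ r₂ ≤ s := fun s hs => by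
    have h3 : φ r₃ ≤ φ s := h.mono (hr₂0.trans_le hr₃) hs (EReal.coe_lt_top s)
    exact ⟨hr₂0.trans_le (hr₃.trans hs), (le_max_left _ _).trans (hφ3.trans h3),
      (le_max_right _ _).trans (hφ3.trans h3), hr₃.trans hs⟩
  -- The lower bound on u involves the denominator at φ/2, so the test is run along φ/2, whose
  -- derivative u/2 is at least 1/6 of that denominator.
  refine hne (lintegral_eq_top_of_le_deriv (φ := fun s => φ s / 2) (u := fun s => u s / 2)
    (r := r₃) (ε := 1 / 6)
    (fun s hs => (h.hasDerivAt_fst s (hin s hs).1 (EReal.coe_lt_top s)).div_const 2)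
    (fun s hs => by linarith [(hin s hs).2.1])
    (continuousOn_one_div_posDenom hf hfpos hg hq1) ht
    (fun s hs => (one_div_pos.2 (posDenom_pos hfpos (ht.trans_le hs))).le) (by norm_num)
    (fun s hs => ?_))
  have hD := h.posDenom_half_le hfm hfpos hgm hq1 ht hg0 hr₂0 ((le_max_left _ _).trans hφ2) hdamp
    (hin s hs).2.2.2 (hin s hs).2.2.1
  have hDpos : 0 < posDenom f g q (φ s / 2) :=
    posDenom_pos hfpos (by linarith [(hin s hs).2.1])
  rw [one_div_mul_eq_div, le_div_iff₀ hDpos]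
  linarith

/-- There is no global radial solution with superlinear gradient growth. -/
theorem le_one_of_global (h : IsRadialFlow f g c q a ⊤ φ u) (hfm : Monotone f)
    (hfpos : ∀ t, 0 < f t) (hgm : Monotone g) (hq : 0 < q) (hc : 1 ≤ c) {t : ℝ}
    (hgt : 0 < g t) : q ≤ 1 := by
  by_contra! hq1
  have hφ := h.tendsto_atTop hfm hfpos hgm hq hc
  -- Eventually f(φ) and g(φ) are at least 2κ and (c-1)/r ≤ κ. As u ≤ 1 + u^q, the damping costs at
  -- most κ + κ u^q, which leaves u' ≥ κ u^q.
  set κ := min (f t) (g t) / 2 with hκ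
  have hκ0 : 0 < κ := half_pos (lt_min (hfpos t) hgt)
  obtain ⟨r₁, hφ1, hr₁⟩ := ((hφ.eventually_ge_atTop t).and
    (eventually_ge_atTop (max 1 ((c - 1) / κ)))).exists
  have hr₁0 : 0 < r₁ := zero_lt_one.trans_le ((le_max_left _ _).trans hr₁)
  have hu1 := h.pos r₁ hr₁0 (EReal.coe_lt_top r₁)
  have hz : ∀ r, r₁ ≤ r → u r ^ (1 - q) + (q - 1) * κ * r ≤
      u r₁ ^ (1 - q) + (q - 1) * κ * r₁ := by
    intro r hr
    have := le_of_hasDerivAt_nonneg (h := fun x => -u x ^ (1 - q) - (q - 1) * κ * x)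
      (h' := fun x => -((f (φ x) + g (φ x) * u x ^ q - (c - 1) / x * u x) * (1 - q) *
        u x ^ (1 - q - 1)) - (q - 1) * κ * 1) hr (fun x hx => by
        have hx0 := hr₁0.trans_le hx.1
        exact ((h.hasDerivAt_snd x hx0 (EReal.coe_lt_top x)).rpow_const
          (Or.inl (h.pos x hx0 (EReal.coe_lt_top x)).ne')).neg.sub
          ((hasDerivAt_id x).const_mul _)) (fun x hx => by
        have hx0 := hr₁0.trans_le hx.1
        have hu := h.pos x hx0 (EReal.coe_lt_top x)
        have htφ : t ≤ φ x := hφ1.trans (h.mono hr₁0 hx.1 (EReal.coe_lt_top x))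
        have e0 : 0 < u x ^ q := Real.rpow_pos_of_pos hu _
        have e1 : 2 * κ ≤ f (φ x) := by
          have := hfm htφ
          have := min_le_left (f t) (g t)
          linarith
        have e2 : 2 * κ * u x ^ q ≤ g (φ x) * u x ^ q := by
          refine mul_le_mul_of_nonneg_right ?_ e0.le
          have := hgm htφ
          have := min_le_right (f t) (g t)
          linarith
        have e3 : (c - 1) / x ≤ κ := by
          rw [div_le_iff₀ hx0]
          have := (div_le_iff₀ hκ0).1 ((le_max_right 1 ((c - 1) / κ)).trans (hr₁.trans hx.1))
          linarith
        have e4 : u x ≤ 1 + u x ^ q := by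
          rcases le_total (u x) 1 with h1 | h1
          · linarith
          · have := Real.rpow_le_rpow_of_exponent_le h1 hq1.le
            rw [Real.rpow_one] at this
            linarith
        have e5 := mul_le_mul_of_nonneg_right e3 hu.le
        have e6 := mul_le_mul_of_nonneg_left e4 hκ0.le
        have e7 : κ * u x ^ q ≤ f (φ x) + g (φ x) * u x ^ q - (c - 1) / x * u x := by linarith
        have e8 : 0 < u x ^ (1 - q - 1) := Real.rpow_pos_of_pos hu _
        have e9 : u x ^ q * u x ^ (1 - q - 1) = 1 := by
          rw [← Real.rpow_add hu, show q + (1 - q - 1) = 0 by ring, Real.rpow_zero]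
        have e10 := mul_le_mul_of_nonneg_right e7
          (mul_nonneg (show 0 ≤ q - 1 by linarith) e8.le)
        have e11 : κ * u x ^ q * ((q - 1) * u x ^ (1 - q - 1)) = (q - 1) * κ := by
          rw [show κ * u x ^ q * ((q - 1) * u x ^ (1 - q - 1)) =
            (q - 1) * κ * (u x ^ q * u x ^ (1 - q - 1)) by ring, e9, mul_one]
        linarith)
    linarith
  have hqk : 0 < (q - 1) * κ := mul_pos (by linarith) hκ0
  have hz1 : 0 < u r₁ ^ (1 - q) := Real.rpow_pos_of_pos hu1 _
  -- At this time the linear upper bound for the positive quantity u^(1-q) has dropped to 0.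
  have hle : r₁ ≤ r₁ + u r₁ ^ (1 - q) / ((q - 1) * κ) :=
    le_add_of_nonneg_right (div_nonneg hz1.le hqk.le)
  have := hz _ hle
  have hpos : 0 < u (r₁ + u r₁ ^ (1 - q) / ((q - 1) * κ)) ^ (1 - q) :=
    Real.rpow_pos_of_pos (h.pos _ (hr₁0.trans_le hle) (EReal.coe_lt_top _)) _
  rw [mul_add, mul_div_cancel₀ _ hqk.ne'] at this
  linarith

end IsRadialFlow

theorem IsMaximalRadialSolution.eq_top_iff_growthConditionPos {f g φ : ℝ → ℝ} {c q a : ℝ}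
    {R : EReal} (h : IsMaximalRadialSolution f g c q a R φ) (hf : Continuous f) (hfm : Monotone f)
    (hfpos : ∀ t, 0 < f t) (hg : Continuous g) (hgm : Monotone g) (hq : 0 < q) (hq' : q ≤ 2)
    (hc : 1 ≤ c) {t : ℝ} (ht : 0 < t) (hgt : 0 < g t) :
    R = ⊤ ↔ GrowthConditionPos f g q := by
  have hfl := h.1.isRadialFlow hf hfpos hg hq hc
  constructor
  · rintro rfl
    have hq1 := hfl.le_one_of_global hfm hfpos hgm hq hc hgt
    exact ⟨hq1, (lintegral_posDenom_eq_top_iff hfm hfpos ht).2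
      (hfl.lintegral_posDenom_eq_top hf hfm hfpos hg hgm hq hq1 hc ht hgt.le)⟩
  · rintro ⟨hq1, hint⟩
    have hint := (lintegral_posDenom_eq_top_iff (g := g) (q := q) hfm hfpos ht).1 hint
    induction R with
    | bot => exact absurd h.1.pos (by simp)
    | top => rfl
    | coe R =>
      exfalso
      have hR : 0 < R := EReal.coe_pos.1 h.1.pos
      obtain ⟨r₁, hr₁, hφ1⟩ := h.unbounded hf hfm hfpos hg hgm hq hq' hc (half_pos hR)
        (half_lt_self hR) t
      have hr₁0 : 0 < r₁ := (half_pos hR).trans_le hr₁.1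
      obtain ⟨C, hC, hCu⟩ := hfl.exists_le_posDenom hfm hfpos hgm hq hq1 hc ht hgt.le hr₁0 hφ1
      have hlt : ∀ {s : ℝ}, s < R → (s : EReal) < R := fun hs => EReal.coe_lt_coe_iff.2 hs
      have htφ : ∀ s ∈ Set.Ico r₁ R, t ≤ φ s := fun s hs =>
        hφ1.trans (hfl.mono hr₁0 hs.1 (hlt hs.2))
      refine (lintegral_lt_top_of_deriv_le (C := C)
        (fun s hs => hfl.hasDerivAt_fst s (hr₁0.trans_le hs.1) (hlt hs.2)) htφ
        (h.unbounded hf hfm hfpos hg hgm hq hq' hc hr₁0 hr₁.2)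
        (continuousOn_one_div_posDenom hf hfpos hg hq1) ht
        (fun s hs => (one_div_pos.2 (posDenom_pos hfpos (ht.trans_le hs))).le)
        (fun s hs => ?_)).ne hint
      have hD : 0 < posDenom f g q (φ s) := posDenom_pos hfpos (ht.trans_le (htφ s hs))
      rw [one_div_mul_eq_div, div_le_iff₀ hD]
      exact hCu s hs.1 (hlt hs.2)

/-! ### The case lim g ≤ 0: the damped integral W -/

/-- The solution of `W' = f (1 - 2 k W)`, `W 0 = 0`. -/
noncomputable def dampedIntegral (f k : ℝ → ℝ) (t : ℝ) : ℝ :=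
  ∫ s in (0 : ℝ)..t, Real.exp (-2 * ∫ τ in s..t, k τ * f τ) * f s

section dampedIntegral

variable {f k : ℝ → ℝ}

theorem hasDerivAt_dampedIntegral (hf : Continuous f) (hk : Continuous k) (t : ℝ) :
    HasDerivAt (dampedIntegral f k) (f t * (1 - 2 * k t * dampedIntegral f k t)) t := by
  set A : ℝ → ℝ := fun x => ∫ τ in (0 : ℝ)..x, k τ * f τ with hA
  have hkf : Continuous fun τ => k τ * f τ := hk.mul hf
  have hAd : ∀ x, HasDerivAt A (k x * f x) x := fun x =>
    (hkf.integral_hasStrictDerivAt 0 x).hasDerivAt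
  have hAc : Continuous A := continuous_iff_continuousAt.2 fun x => (hAd x).continuousAt
  have hAf : Continuous fun s => Real.exp (2 * A s) * f s := by fun_prop
  -- With A a primitive of k f, the exponential splits as e^(-2A(x)) e^(2A(s)), which removes x from
  -- the integrand.
  have heq : dampedIntegral f k =
      fun x => Real.exp (-2 * A x) * ∫ s in (0 : ℝ)..x, Real.exp (2 * A s) * f s := by
    funext x
    rw [dampedIntegral, ← intervalIntegral.integral_const_mul]
    refine intervalIntegral.integral_congr fun s _ => ?_
    rw [← mul_assoc, ← Real.exp_add, ← intervalIntegral.integral_interval_sub_left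
      (hkf.intervalIntegrable 0 x) (hkf.intervalIntegrable 0 s)]
    congr 2
    simp only [hA]
    ring
  have h1 : HasDerivAt (fun x => ∫ s in (0 : ℝ)..x, Real.exp (2 * A s) * f s)
      (Real.exp (2 * A t) * f t) t := (hAf.integral_hasStrictDerivAt 0 t).hasDerivAt
  have h2 := (((hAd t).const_mul (-2)).exp).mul h1
  have h3 : Real.exp (-2 * A t) * Real.exp (2 * A t) = 1 := by
    rw [← Real.exp_add]
    simp
  rw [heq]
  refine h2.congr_deriv ?_
  linear_combination f t * h3

theorem dampedIntegral_zero : dampedIntegral f k 0 = 0 := by simp [dampedIntegral]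

theorem continuous_dampedIntegral (hf : Continuous f) (hk : Continuous k) :
    Continuous (dampedIntegral f k) :=
  continuous_iff_continuousAt.2 fun t => (hasDerivAt_dampedIntegral hf hk t).continuousAt

variable (hf : Continuous f) (hfm : Monotone f) (hfpos : ∀ t, 0 < f t) (hk : Continuous k)
  (hka : Antitone k) (hk0 : ∀ t, 0 ≤ k t)

include hf hfm hfpos hk hka hk0

/-- While W < ε t on [0, T], the choice of ε keeps 2 k W ≤ 1/2, so W' ≥ f(0)/2 ≥ ε. This gives
positivity of W and integrability of W^(-1/2) near 0. -/
theorem exists_mul_le_dampedIntegral {T : ℝ} (hT : 0 < T) :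
    ∃ ε : ℝ, 0 < ε ∧ ∀ t, 0 ≤ t → t ≤ T → ε * t ≤ dampedIntegral f k t := by
  have hf0 := hfpos 0
  have hkf : 0 ≤ k 0 * f 0 * T := mul_nonneg (mul_nonneg (hk0 0) hf0.le) hT.le
  set P := 1 + 2 * (k 0 * f 0 * T) with hP
  have hP0 : 0 < P := by linarith
  set ε := f 0 / (2 * P) with hε
  have hε0 : 0 < ε := by positivity
  have hεP : 2 * ε * P = f 0 := by rw [hε]; field_simp
  refine ⟨ε, hε0, fun t ht htT => ?_⟩
  have := nonneg_of_barrier (h := fun s => dampedIntegral f k s - ε * s) ht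
    (fun s _ => (hasDerivAt_dampedIntegral hf hk s).sub ((hasDerivAt_id s).const_mul ε))
    (by simp [dampedIntegral_zero]) (fun s hs hneg => ?_)
  · linarith
  · have h1 : k s * dampedIntegral f k s ≤ k 0 * (ε * T) := by
      have e1 : dampedIntegral f k s ≤ ε * T := by
        have := mul_le_mul_of_nonneg_left (hs.2.trans htT) hε0.le
        linarith
      exact (mul_le_mul_of_nonneg_left e1 (hk0 s)).trans
        (mul_le_mul_of_nonneg_right (hka hs.1) (mul_nonneg hε0.le hT.le))
    have h2 : 4 * (k 0 * (ε * T)) ≤ 1 := by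
      have e : 4 * (k 0 * (ε * T)) * P = 2 * (k 0 * f 0 * T) := by
        rw [← hεP]; ring
      have : 4 * (k 0 * (ε * T)) * P ≤ 1 * P := by rw [e]; linarith
      exact le_of_mul_le_mul_right this hP0
    have h3 := mul_le_mul (hfm hs.1) (show 1 / 2 ≤ 1 - 2 * k s * dampedIntegral f k s by linarith)
      (by norm_num) (hfpos s).le
    have h4 : 2 * ε ≤ f 0 := by
      have := mul_nonneg hε0.le hkf
      rw [← hεP, hP]
      linarith
    linarith

theorem dampedIntegral_pos {t : ℝ} (ht : 0 < t) : 0 < dampedIntegral f k t := by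
  obtain ⟨ε, hε, h⟩ := exists_mul_le_dampedIntegral hf hfm hfpos hk hka hk0 ht
  exact (mul_pos hε ht).trans_le (h t ht.le le_rfl)

theorem dampedIntegral_nonneg {t : ℝ} (ht : 0 ≤ t) : 0 ≤ dampedIntegral f k t := by
  rcases ht.eq_or_lt with rfl | h
  · exact dampedIntegral_zero.ge
  · exact (dampedIntegral_pos hf hfm hfpos hk hka hk0 h).le

/-- W decreases wherever 2 k W > 1, and k is antitone, so 1/(2 k(t)) with t frozen is a barrier on
[0, t]. -/
theorem two_mul_mul_dampedIntegral_le_one {t : ℝ} (ht : 0 ≤ t) :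
    2 * k t * dampedIntegral f k t ≤ 1 := by
  have := nonneg_of_barrier (h := fun s => 1 - 2 * k t * dampedIntegral f k s) ht
    (fun s _ => ((hasDerivAt_dampedIntegral hf hk s).const_mul (2 * k t)).const_sub 1)
    (by simp [dampedIntegral_zero]) (fun s hs hneg => ?_)
  · linarith
  · have h1 := mul_le_mul_of_nonneg_right (hka hs.2)
      (dampedIntegral_nonneg hf hfm hfpos hk hka hk0 hs.1)
    have h2 : 0 ≤ 2 * k t * f s * (2 * k s * dampedIntegral f k s - 1) :=
      mul_nonneg (mul_nonneg (mul_nonneg two_pos.le (hk0 t)) (hfpos s).le) (by linarith)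
    linarith

theorem dampedIntegral_mono {s t : ℝ} (hs : 0 ≤ s) (hst : s ≤ t) :
    dampedIntegral f k s ≤ dampedIntegral f k t :=
  le_of_hasDerivAt_nonneg hst (fun x _ => hasDerivAt_dampedIntegral hf hk x)
    (fun x hx => mul_nonneg (hfpos x).le (sub_nonneg.2
      (two_mul_mul_dampedIntegral_le_one hf hfm hfpos hk hka hk0 (hs.trans hx.1))))

theorem dampedIntegral_le_mul {t : ℝ} (ht : 0 ≤ t) : dampedIntegral f k t ≤ t * f t := by
  have := le_of_hasDerivAt_nonneg (h := fun s => f t * s - dampedIntegral f k s) ht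
    (fun x _ => ((hasDerivAt_id x).const_mul (f t)).sub (hasDerivAt_dampedIntegral hf hk x))
    (fun x hx => by
      have h1 := hfm hx.2
      have h2 : 0 ≤ f x * (2 * k x * dampedIntegral f k x) :=
        mul_nonneg (hfpos x).le (mul_nonneg (mul_nonneg two_pos.le (hk0 x))
          (dampedIntegral_nonneg hf hfm hfpos hk hka hk0 hx.1))
      linarith)
  simp only [dampedIntegral_zero, mul_zero, sub_zero] at this
  linarith

theorem continuousOn_one_div_sqrt_dampedIntegral :
    ContinuousOn (fun t => 1 / dampedIntegral f k t ^ (1 / 2 : ℝ)) (Set.Ioi 0) :=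
  continuousOn_const.div
    ((continuous_dampedIntegral hf hk).rpow_const fun _ => Or.inr (by norm_num)).continuousOn
    fun _ ht => (Real.rpow_pos_of_pos (dampedIntegral_pos hf hfm hfpos hk hka hk0 ht) _).ne'

theorem lintegral_dampedIntegral_eq_top_iff {t : ℝ} (ht : 0 < t) :
    ∫⁻ s in Set.Ioi (0 : ℝ), ENNReal.ofReal (1 / dampedIntegral f k s ^ (1 / 2 : ℝ)) = ⊤ ↔
      ∫⁻ s in Set.Ioi t, ENNReal.ofReal (1 / dampedIntegral f k s ^ (1 / 2 : ℝ)) = ⊤ := by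
  obtain ⟨ε, hε, h⟩ := exists_mul_le_dampedIntegral hf hfm hfpos hk hka hk0 ht
  refine lintegral_Ioi_eq_top_iff (K := 1 / ε ^ (1 / 2 : ℝ)) ht fun s hs => ?_
  have h0 : 0 < ε ^ (1 / 2 : ℝ) * s ^ (1 / 2 : ℝ) :=
    mul_pos (Real.rpow_pos_of_pos hε _) (Real.rpow_pos_of_pos hs.1 _)
  have h1 : ε ^ (1 / 2 : ℝ) * s ^ (1 / 2 : ℝ) ≤ dampedIntegral f k s ^ (1 / 2 : ℝ) := by
    rw [← Real.mul_rpow hε.le hs.1.le]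
    exact Real.rpow_le_rpow (mul_pos hε hs.1).le (h s hs.1.le hs.2) (by norm_num)
  refine (one_div_le_one_div_of_le h0 h1).trans (le_of_eq ?_)
  rw [Real.rpow_neg hs.1.le]
  field_simp

end dampedIntegral

/-- The coefficient `(g⁻ / f) ^ (2 / q)`. -/
noncomputable def gradCoeff (f g : ℝ → ℝ) (q t : ℝ) : ℝ := ((g t)⁻ / f t) ^ (2 / q)

section gradCoeff

variable {f g : ℝ → ℝ} {q : ℝ}

theorem continuous_gradCoeff (hf : Continuous f) (hfpos : ∀ t, 0 < f t) (hg : Continuous g)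
    (hq : 0 < q) : Continuous (gradCoeff f g q) := by
  have hg' : Continuous fun t => (g t)⁻ := hg.neg.sup continuous_const
  exact (hg'.div hf fun t => (hfpos t).ne').rpow_const fun _ => Or.inr (by positivity)

theorem gradCoeff_nonneg (hfpos : ∀ t, 0 < f t) (t : ℝ) : 0 ≤ gradCoeff f g q t :=
  Real.rpow_nonneg (div_nonneg (negPart_nonneg _) (hfpos t).le) _

theorem antitone_gradCoeff (hfm : Monotone f) (hfpos : ∀ t, 0 < f t) (hgm : Monotone g)
    (hq : 0 < q) : Antitone (gradCoeff f g q) := fun s t hst =>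
  Real.rpow_le_rpow (div_nonneg (negPart_nonneg _) (hfpos t).le)
    (div_le_div₀ (negPart_nonneg _) (negPart_anti (hgm hst)) (hfpos s) (hfm hst)) (by positivity)

/-- With X = g⁻ u^q / f the ratio of the gradient term to the source, this reads k u² = X^(2/q) and
translates between X and the energy. -/
theorem gradCoeff_mul_sq (hfpos : ∀ t, 0 < f t) (hq : 0 < q) {t p : ℝ} (hp : 0 ≤ p) :
    gradCoeff f g q t * p ^ 2 = ((g t)⁻ / f t * p ^ q) ^ (2 / q) := by
  rw [Real.mul_rpow (div_nonneg (negPart_nonneg _) (hfpos t).le) (Real.rpow_nonneg hp _),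
    ← Real.rpow_mul hp, mul_div_cancel₀ _ hq.ne', Real.rpow_two, gradCoeff]

end gradCoeff

namespace IsRadialFlow

variable {f g φ u : ℝ → ℝ} {c q a : ℝ} {R : EReal}

/-- Let M be the slope at which gradient term and source balance at the level φ(r). At earlier times
f is smaller and g⁻ larger, so u' ≤ 0 whenever u > M; since u starts near 0, it stays below M up to
r. -/
theorem negPart_mul_le (h : IsRadialFlow f g c q a R φ u) (hfm : Monotone f)
    (hfpos : ∀ t, 0 < f t) (hgm : Monotone g) (hg0 : ∀ t, g t ≤ 0) (hq : 0 < q) (hc : 1 ≤ c)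
    {r : ℝ} (hr : 0 < r) (hrR : (r : EReal) < R) : (g (φ r))⁻ * u r ^ q ≤ f (φ r) := by
  by_contra! hlt
  have hur := h.pos r hr hrR
  have huq : 0 < u r ^ q := Real.rpow_pos_of_pos hur _
  have hG : 0 < (g (φ r))⁻ := by
    rcases (negPart_nonneg (g (φ r))).eq_or_lt with h0 | h0
    · rw [← h0, zero_mul] at hlt
      exact absurd hlt (hfpos _).not_gt
    · exact h0
  set M := (f (φ r) / (g (φ r))⁻) ^ (1 / q) with hM
  have hM0 : 0 < M := Real.rpow_pos_of_pos (div_pos (hfpos _) hG) _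
  have hMq : (g (φ r))⁻ * M ^ q = f (φ r) := by
    rw [hM, ← Real.rpow_mul (div_pos (hfpos _) hG).le, one_div_mul_cancel hq.ne', Real.rpow_one,
      mul_div_cancel₀ _ hG.ne']
  obtain ⟨s₀, hs₀, hs₀r⟩ := ((h.tendsto_snd.eventually (gt_mem_nhds hM0)).and
    (Ioo_mem_nhdsGT hr)).exists
  have := nonneg_of_barrier (h := fun s => M - u s) hs₀r.2.le
    (fun s hs => (h.hasDerivAt_snd s (hs₀r.1.trans_le hs.1) (coe_lt_of_le hs.2 hrR)).const_sub M)
    (by linarith) (fun s hs hneg => ?_)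
  · have h1 : u r ^ q ≤ M ^ q := Real.rpow_le_rpow hur.le (by linarith) hq.le
    have := mul_le_mul_of_nonneg_left h1 hG.le
    linarith
  · have hs0 := hs₀r.1.trans_le hs.1
    have hsR := coe_lt_of_le hs.2 hrR
    have hφ := h.mono hs0 hs.2 hrR
    have e1 := hfm hφ
    have e2 := negPart_anti (hgm hφ)
    have e3 : M ^ q ≤ u s ^ q := Real.rpow_le_rpow hM0.le (by linarith) hq.le
    have e4 := mul_le_mul e2 e3 (Real.rpow_nonneg hM0.le _) (negPart_nonneg _)
    have e5 : g (φ s) = -(g (φ s))⁻ := by rw [negPart_eq_neg.2 (hg0 _), neg_neg]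
    have e6 : 0 ≤ (c - 1) / s * u s :=
      mul_nonneg (div_nonneg (by linarith) hs0.le) (h.pos s hs0 hsR).le
    rw [e5]
    linarith

/-- The energy is controlled from above by the damped integral. -/
theorem exists_sq_le_dampedIntegral (h : IsRadialFlow f g c q a R φ u) (hf : Continuous f)
    (hfm : Monotone f) (hfpos : ∀ t, 0 < f t) (hg : Continuous g) (hgm : Monotone g)
    (hg0 : ∀ t, g t ≤ 0) (hq : 0 < q) (hq' : q ≤ 2) (hc : 1 ≤ c) {r₁ : ℝ} (hr₁ : 0 < r₁)
    (hφ1 : 0 < φ r₁) :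
    ∃ C, ∀ r, r₁ ≤ r → (r : EReal) < R →
      u r ^ 2 ≤ C * dampedIntegral f (gradCoeff f g q) (φ r) := by
  have hk := continuous_gradCoeff hf hfpos hg hq
  have hW1 := dampedIntegral_pos hf hfm hfpos hk (antitone_gradCoeff hfm hfpos hgm hq)
    (gradCoeff_nonneg hfpos) hφ1
  set W := dampedIntegral f (gradCoeff f g q)
  set C := max 2 (u r₁ ^ 2 / W (φ r₁)) with hC
  refine ⟨C, fun r hr hrR => ?_⟩
  have := nonneg_of_barrier (h := fun s => C * W (φ s) - u s ^ 2)
    (h' := fun s => C * (f (φ s) * (1 - 2 * gradCoeff f g q (φ s) * W (φ s)) * u s) -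
      2 * u s * (f (φ s) + g (φ s) * u s ^ q - (c - 1) / s * u s)) hr
    (fun s hs => by
      have hs0 := hr₁.trans_le hs.1
      have hsR := coe_lt_of_le hs.2 hrR
      refine ((((hasDerivAt_dampedIntegral hf hk (φ s)).comp s
        (h.hasDerivAt_fst s hs0 hsR)).const_mul C).sub
        ((h.hasDerivAt_snd s hs0 hsR).pow 2)).congr_deriv ?_
      simp [W])
    (by
      have := (div_le_iff₀ hW1).1 (le_max_right 2 (u r₁ ^ 2 / W (φ r₁)))
      linarith) (fun s hs hneg => ?_)
  · linarith
  · have hs0 := hr₁.trans_le hs.1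
    have hsR := coe_lt_of_le hs.2 hrR
    have hu := h.pos s hs0 hsR
    have hfs := hfpos (φ s)
    have hX0 : 0 ≤ (g (φ s))⁻ / f (φ s) * u s ^ q :=
      mul_nonneg (div_nonneg (negPart_nonneg _) hfs.le) (Real.rpow_nonneg hu.le _)
    have hX1 : (g (φ s))⁻ / f (φ s) * u s ^ q ≤ 1 := by
      rw [div_mul_eq_mul_div, div_le_one hfs]
      exact h.negPart_mul_le hfm hfpos hgm hg0 hq hc hs0 hsR
    -- Here q ≤ 2 enters: X ≤ 1 and 2/q ≥ 1 give X^(2/q) ≤ X. So (u²)' ≤ 2 f u (1 - k u²), and C ≥ 2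
    -- makes C W a barrier from above.
    have hXk : gradCoeff f g q (φ s) * u s ^ 2 ≤ (g (φ s))⁻ / f (φ s) * u s ^ q := by
      rw [gradCoeff_mul_sq hfpos hq hu.le]
      exact Real.rpow_le_self_of_le_one hX0 hX1 ((one_le_div hq).2 hq')
    have e1 : g (φ s) * u s ^ q = -(f (φ s) * ((g (φ s))⁻ / f (φ s) * u s ^ q)) := by
      have : (g (φ s))⁻ = -g (φ s) := negPart_eq_neg.2 (hg0 _)
      rw [this]
      field_simp
    have e2 : 0 ≤ (c - 1) / s * u s := mul_nonneg (div_nonneg (by linarith) hs0.le) hu.le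
    have e3 := mul_le_mul_of_nonneg_left hXk hfs.le
    have e4 := mul_nonneg (gradCoeff_nonneg (g := g) (q := q) hfpos (φ s))
      (show 0 ≤ u s ^ 2 - C * W (φ s) by linarith)
    have e5 : 2 ≤ C := le_max_left _ _
    have e6 : 0 ≤ u s * f (φ s) * ((C - 2) + 2 * (gradCoeff f g q (φ s) *
        (u s ^ 2 - C * W (φ s)))) :=
      mul_nonneg (mul_nonneg hu.le hfs.le) (by linarith)
    have e7 := mul_nonneg hu.le (show 0 ≤ -(g (φ s) * u s ^ q) -
      f (φ s) * (gradCoeff f g q (φ s) * u s ^ 2) + (c - 1) / s * u s by linarith)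
    linarith

/-- If the integral converged, W^(1/2) would be superlinear; with W ≤ t f(t) this makes the damping
at most f/4 wherever u² < ε W. Then ε W is a lower barrier for u², which forces divergence. -/
theorem lintegral_dampedIntegral_eq_top (h : IsRadialFlow f g c q a ⊤ φ u) (hf : Continuous f)
    (hfm : Monotone f) (hfpos : ∀ t, 0 < f t) (hg : Continuous g) (hgm : Monotone g)
    (hg0 : ∀ t, g t ≤ 0) (hq : 0 < q) (hc : 1 ≤ c) :
    ∫⁻ s in Set.Ioi (1 : ℝ),
      ENNReal.ofReal (1 / dampedIntegral f (gradCoeff f g q) s ^ (1 / 2 : ℝ)) = ⊤ := by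
  have hk := continuous_gradCoeff hf hfpos hg hq
  have hka := antitone_gradCoeff hfm hfpos hgm hq
  have hk0 := gradCoeff_nonneg (g := g) (q := q) hfpos
  have hWpos : ∀ t, 0 < t → 0 < dampedIntegral f (gradCoeff f g q) t := fun t ht =>
    dampedIntegral_pos hf hfm hfpos hk hka hk0 ht
  by_contra hne
  have hφ := h.tendsto_atTop hfm hfpos hgm hq hc
  set W := dampedIntegral f (gradCoeff f g q) with hW
  set K := c - 1 with hK
  have hK0 : 0 ≤ K := by linarith
  have hLW := eventually_mul_le_of_lintegral_inv_ne_top one_pos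
    ((continuous_dampedIntegral hf hk).rpow_const fun _ => Or.inr (by norm_num)).continuousOn
    (fun s hs => Real.rpow_pos_of_pos (hWpos s (one_pos.trans_le hs)) _)
    (fun s x hs hsx => Real.rpow_le_rpow (hWpos s (one_pos.trans_le hs)).le
      (dampedIntegral_mono hf hfm hfpos hk hka hk0 (zero_le_one.trans hs) hsx) (by norm_num))
    hne (4 * K)
  obtain ⟨t₂, ht₂⟩ := eventually_atTop.1 hLW
  obtain ⟨r₁, hφ1, hr₁⟩ := ((hφ.eventually_ge_atTop (max 1 t₂)).and
    (eventually_ge_atTop 1)).exists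
  have hr₁0 : 0 < r₁ := zero_lt_one.trans_le hr₁
  have hin : ∀ s, r₁ ≤ s → 0 < s ∧ 1 ≤ φ s ∧ t₂ ≤ φ s ∧ 0 < u s ∧ 0 < W (φ s) := fun s hs => by
    have h3 : φ r₁ ≤ φ s := h.mono hr₁0 hs (EReal.coe_lt_top s)
    have h4 : 1 ≤ φ s := (le_max_left _ _).trans (hφ1.trans h3)
    exact ⟨hr₁0.trans_le hs, h4, (le_max_right _ _).trans (hφ1.trans h3),
      h.pos s (hr₁0.trans_le hs) (EReal.coe_lt_top s), hWpos _ (by linarith)⟩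
  obtain ⟨-, -, -, hu1, hW1⟩ := hin r₁ le_rfl
  -- The first entry makes the gradient term at most f/4 where u² < ε W; the second gives u ≤
  -- W^(1/2) and closes the comparison; the third starts the barrier at r₁.
  set ε := min (min ((1 / 4 : ℝ) ^ (2 / q)) (1 / 4)) (u r₁ ^ 2 / W (φ r₁)) with hε
  have hε0 : 0 < ε := lt_min (lt_min (by positivity) (by norm_num)) (by positivity)
  have hε1 : ε ≤ (1 / 4 : ℝ) ^ (2 / q) := (min_le_left _ _).trans (min_le_left _ _)
  have hε2 : ε ≤ 1 / 4 := (min_le_left _ _).trans (min_le_right _ _)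
  have hlow : ∀ r, r₁ ≤ r → ε * W (φ r) ≤ u r ^ 2 := by
    intro r hr
    have := nonneg_of_barrier (h := fun s => u s ^ 2 - ε * W (φ s))
      (h' := fun s => 2 * u s * (f (φ s) + g (φ s) * u s ^ q - (c - 1) / s * u s) -
        ε * (f (φ s) * (1 - 2 * gradCoeff f g q (φ s) * W (φ s)) * u s)) hr
      (fun s hs => by
        have hs0 := (hin s hs.1).1
        refine (((h.hasDerivAt_snd s hs0 (EReal.coe_lt_top s)).pow 2).sub
          (((hasDerivAt_dampedIntegral hf hk (φ s)).comp s
          (h.hasDerivAt_fst s hs0 (EReal.coe_lt_top s))).const_mul ε)).congr_deriv ?_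
        simp [W])
      (by
        have := (le_div_iff₀ hW1).1 (min_le_right (min ((1 / 4 : ℝ) ^ (2 / q)) (1 / 4))
          (u r₁ ^ 2 / W (φ r₁)))
        linarith) (fun s hs hneg => ?_)
    · linarith
    · obtain ⟨hs0, h1φ, ht2, hu, hWs⟩ := hin s hs.1
      have hfs := hfpos (φ s)
      have hφ0 : 0 < φ s := by linarith
      have hkW := two_mul_mul_dampedIntegral_le_one hf hfm hfpos hk hka hk0 hφ0.le
      have hkWn : 0 ≤ 2 * gradCoeff f g q (φ s) * W (φ s) :=
        mul_nonneg (mul_nonneg two_pos.le (hk0 _)) hWs.le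
      have hX0 : 0 ≤ (g (φ s))⁻ / f (φ s) * u s ^ q :=
        mul_nonneg (div_nonneg (negPart_nonneg _) hfs.le) (Real.rpow_nonneg hu.le _)
      have hX : (g (φ s))⁻ / f (φ s) * u s ^ q ≤ 1 / 4 := by
        have e1 : ((g (φ s))⁻ / f (φ s) * u s ^ q) ^ (2 / q) ≤ (1 / 4 : ℝ) ^ (2 / q) := by
          rw [← gradCoeff_mul_sq hfpos hq hu.le]
          have e2 := mul_le_mul_of_nonneg_left (show u s ^ 2 ≤ ε * W (φ s) by linarith) (hk0 (φ s))
          have e3 := mul_le_mul_of_nonneg_left hkW hε0.le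
          have : gradCoeff f g q (φ s) * (ε * W (φ s)) ≤ ε := by linarith
          linarith
        exact (Real.rpow_le_rpow_iff hX0 (by norm_num) (by positivity)).1 e1
      have e1 : g (φ s) * u s ^ q = -(f (φ s) * ((g (φ s))⁻ / f (φ s) * u s ^ q)) := by
        have : (g (φ s))⁻ = -g (φ s) := negPart_eq_neg.2 (hg0 _)
        rw [this]
        field_simp
      have e2 := mul_le_mul_of_nonneg_left hX hfs.le
      have e3 : u s ≤ W (φ s) ^ (1 / 2 : ℝ) := by
        rw [← Real.sqrt_eq_rpow]
        refine Real.le_sqrt_of_sq_le ?_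
        have := mul_le_mul_of_nonneg_right hε2 hWs.le
        linarith
      have e4 : 4 * K * W (φ s) ^ (1 / 2 : ℝ) ≤ f (φ s) := by
        have e5 := ht₂ (φ s) ht2
        have e6 := dampedIntegral_le_mul hf hfm hfpos hk hka hk0 hφ0.le
        have e7 : W (φ s) ^ (1 / 2 : ℝ) * W (φ s) ^ (1 / 2 : ℝ) = W (φ s) := by
          rw [← Real.sqrt_eq_rpow, Real.mul_self_sqrt hWs.le]
        have e8 := mul_le_mul_of_nonneg_right e5 (Real.rpow_nonneg hWs.le (1 / 2 : ℝ))
        have e9 : φ s * (4 * K * W (φ s) ^ (1 / 2 : ℝ)) ≤ φ s * f (φ s) := by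
          have e6' : W (φ s) ≤ φ s * f (φ s) := e6
          linarith
        exact le_of_mul_le_mul_left e9 hφ0
      have e5 : (c - 1) / s * u s ≤ f (φ s) / 4 := by
        have e6 : K / s ≤ K := div_le_self hK0 (hr₁.trans hs.1)
        have e7 := mul_le_mul e6 e3 hu.le hK0
        linarith
      have e6 := mul_le_mul_of_nonneg_left
        (show f (φ s) / 2 ≤ f (φ s) + g (φ s) * u s ^ q - (c - 1) / s * u s by linarith)
        (show 0 ≤ 2 * u s by linarith)
      have hfu := mul_pos hfs hu
      have e7 : ε * (f (φ s) * (1 - 2 * gradCoeff f g q (φ s) * W (φ s)) * u s) ≤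
          1 * (f (φ s) * u s) := by
        refine mul_le_mul (by linarith) ?_ ?_ zero_le_one
        · have := mul_nonneg hfu.le hkWn
          linarith
        · exact mul_nonneg (mul_nonneg hfs.le (by linarith)) hu.le
      linarith
  refine hne (lintegral_eq_top_of_le_deriv (φ := φ) (u := u) (r := r₁) (ε := ε ^ (1 / 2 : ℝ))
    (fun s hs => h.hasDerivAt_fst s (hin s hs).1 (EReal.coe_lt_top s))
    (fun s hs => (hin s hs).2.1)
    (continuousOn_one_div_sqrt_dampedIntegral hf hfm hfpos hk hka hk0) one_pos
    (fun s hs => (one_div_pos.2 (Real.rpow_pos_of_pos (hWpos s (by linarith)) _)).le)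
    (Real.rpow_pos_of_pos hε0 _) (fun s hs => ?_))
  obtain ⟨hs0, h1φ, ht2, hu, hWs⟩ := hin s hs
  rw [one_div_mul_eq_div, le_div_iff₀ (Real.rpow_pos_of_pos hWs _),
    ← Real.mul_rpow hε0.le hWs.le, ← Real.sqrt_eq_rpow]
  exact (Real.sqrt_le_left hu.le).2 (hlow s hs)

end IsRadialFlow

theorem IsMaximalRadialSolution.eq_top_iff_growthConditionNonpos {f g φ : ℝ → ℝ} {c q a : ℝ}
    {R : EReal} (h : IsMaximalRadialSolution f g c q a R φ) (hf : Continuous f) (hfm : Monotone f)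
    (hfpos : ∀ t, 0 < f t) (hg : Continuous g) (hgm : Monotone g) (hg0 : ∀ t, g t ≤ 0)
    (hq : 0 < q) (hq' : q ≤ 2) (hc : 1 ≤ c) :
    R = ⊤ ↔ GrowthConditionNonpos f g q := by
  have hfl := h.1.isRadialFlow hf hfpos hg hq hc
  have hk := continuous_gradCoeff hf hfpos hg hq
  have hka := antitone_gradCoeff hfm hfpos hgm hq
  have hk0 := gradCoeff_nonneg (g := g) (q := q) hfpos
  have hiff := lintegral_dampedIntegral_eq_top_iff hf hfm hfpos hk hka hk0 one_pos
  constructor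
  · rintro rfl
    exact hiff.2 (hfl.lintegral_dampedIntegral_eq_top hf hfm hfpos hg hgm hg0 hq hc)
  · intro hint
    have hint := hiff.1 hint
    induction R with
    | bot => exact absurd h.1.pos (by simp)
    | top => rfl
    | coe R =>
      exfalso
      have hR : 0 < R := EReal.coe_pos.1 h.1.pos
      obtain ⟨r₁, hr₁, hφ1⟩ := h.unbounded hf hfm hfpos hg hgm hq hq' hc (half_pos hR)
        (half_lt_self hR) 1
      have hr₁0 : 0 < r₁ := (half_pos hR).trans_le hr₁.1
      obtain ⟨C, hCu⟩ := hfl.exists_sq_le_dampedIntegral hf hfm hfpos hg hgm hg0 hq hq' hc hr₁0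
        (one_pos.trans_le hφ1)
      have hlt : ∀ {s : ℝ}, s < R → (s : EReal) < R := fun hs => EReal.coe_lt_coe_iff.2 hs
      have htφ : ∀ s ∈ Set.Ico r₁ R, 1 ≤ φ s := fun s hs =>
        hφ1.trans (hfl.mono hr₁0 hs.1 (hlt hs.2))
      refine (lintegral_lt_top_of_deriv_le (C := |C| ^ (1 / 2 : ℝ))
        (fun s hs => hfl.hasDerivAt_fst s (hr₁0.trans_le hs.1) (hlt hs.2)) htφ
        (h.unbounded hf hfm hfpos hg hgm hq hq' hc hr₁0 hr₁.2)
        (continuousOn_one_div_sqrt_dampedIntegral hf hfm hfpos hk hka hk0) one_pos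
        (fun s hs => (one_div_pos.2 (Real.rpow_pos_of_pos
          (dampedIntegral_pos hf hfm hfpos hk hka hk0 (one_pos.trans_le hs)) _)).le)
        (fun s hs => ?_)).ne hint
      have hW := dampedIntegral_pos hf hfm hfpos hk hka hk0 (one_pos.trans_le (htφ s hs))
      rw [one_div_mul_eq_div, div_le_iff₀ (Real.rpow_pos_of_pos hW _),
        ← Real.mul_rpow (abs_nonneg C) hW.le, ← Real.sqrt_eq_rpow]
      refine Real.le_sqrt_of_sq_le ((hCu s hs.1 (hlt hs.2)).trans ?_)
      exact mul_le_mul_of_nonneg_right (le_abs_self C) hW.le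

/-! ### The case lim g < 0: equivalence of (3) and (4) -/

/-- If W stayed below μ on [t, 2t], then 2 k W ≤ 1/2 there, so W' ≥ f(t)/2 and W would gain t f(t)/2
≥ μ. -/
theorem min_le_dampedIntegral {f k : ℝ → ℝ} (hf : Continuous f) (hfm : Monotone f)
    (hfpos : ∀ t, 0 < f t) (hk : Continuous k) (hka : Antitone k) (hk0 : ∀ t, 0 ≤ k t) {t μ : ℝ}
    (ht : 0 < t) (hμ : 4 * k t * μ ≤ 1) (hμ' : μ ≤ t * f t / 2) :
    μ ≤ dampedIntegral f k (2 * t) := by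
  by_contra! hlt
  have := le_of_hasDerivAt_nonneg (h := fun s => dampedIntegral f k s - f t / 2 * s)
    (show t ≤ 2 * t by linarith)
    (fun x _ => (hasDerivAt_dampedIntegral hf hk x).sub ((hasDerivAt_id x).const_mul (f t / 2)))
    (fun x hx => by
      have hx0 : 0 ≤ x := ht.le.trans hx.1
      have e1 : dampedIntegral f k x ≤ μ :=
        (dampedIntegral_mono hf hfm hfpos hk hka hk0 hx0 hx.2).trans hlt.le
      have e2 : k x * dampedIntegral f k x ≤ k t * μ :=
        mul_le_mul (hka hx.1) e1 (dampedIntegral_nonneg hf hfm hfpos hk hka hk0 hx0) (hk0 t)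
      have e3 := mul_le_mul (hfm hx.1) (show 1 / 2 ≤ 1 - 2 * k x * dampedIntegral f k x by linarith)
        (by norm_num) (hfpos x).le
      linarith)
  have h1 := dampedIntegral_nonneg hf hfm hfpos hk hka hk0 ht.le
  linarith

theorem setLIntegral_Ioi_comp_two_mul (w : ℝ → ENNReal) :
    ∫⁻ s in Set.Ioi (0 : ℝ), w s = 2 * ∫⁻ s in Set.Ioi (0 : ℝ), w (2 * s) := by
  have himg : (fun s : ℝ => 2 * s) '' Set.Ioi 0 = Set.Ioi 0 := by
    rw [Set.image_mul_left_Ioi two_pos, mul_zero]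
  conv_lhs => rw [← himg]
  rw [lintegral_image_eq_lintegral_abs_deriv_mul measurableSet_Ioi (f' := fun _ => 2)
    (fun x _ => by simpa using ((hasDerivAt_id x).const_mul (2 : ℝ)).hasDerivWithinAt)
    (fun x _ y _ hxy => by simpa using hxy), lintegral_const_mul' _ _ (by simp)]
  simp

/-- From above, W ≤ t f and k W ≤ 1 with g⁻ ≥ m bound W by multiples of t f and f^(2/q). From below,
W(2t) is at least a multiple of their minimum because g⁻(t) ≤ g⁻(0) for t ≥ 0. -/
theorem growthConditionNonpos_iff_growthConditionNeg {f g : ℝ → ℝ} {q m : ℝ} (hf : Continuous f)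
    (hfm : Monotone f) (hfpos : ∀ t, 0 < f t) (hg : Continuous g) (hgm : Monotone g)
    (hm : 0 < m) (hgneg : ∀ t, g t ≤ -m) (hq : 0 < q) :
    GrowthConditionNonpos f g q ↔ GrowthConditionNeg f q := by
  have hk := continuous_gradCoeff hf hfpos hg hq
  have hka := antitone_gradCoeff hfm hfpos hgm hq
  have hk0 := gradCoeff_nonneg (g := g) (q := q) hfpos
  have hWpos : ∀ t, 0 < t → 0 < dampedIntegral f (gradCoeff f g q) t := fun t ht =>
    dampedIntegral_pos hf hfm hfpos hk hka hk0 ht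
  have hG : ∀ t, (g t)⁻ = -g t := fun t => negPart_eq_neg.2 (by linarith [hgneg t])
  have hGm : ∀ t, m ≤ (g t)⁻ := fun t => by rw [hG]; linarith [hgneg t]
  have hksqrt : ∀ t, gradCoeff f g q t = ((g t)⁻ / f t) ^ (1 / q) * ((g t)⁻ / f t) ^ (1 / q) := by
    intro t
    rw [← Real.rpow_add (div_pos (hm.trans_le (hGm t)) (hfpos t)), gradCoeff]
    congr 1
    ring
  set W := dampedIntegral f (gradCoeff f g q) with hW
  have hWdef : GrowthConditionNonpos f g q ↔
    ∫⁻ t in Set.Ioi (0 : ℝ), ENNReal.ofReal (1 / W t ^ (1 / 2 : ℝ)) = ⊤ := Iff.rfl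
  rw [hWdef, GrowthConditionNeg]
  have hWsq : ∀ t, 0 < t → W t ^ (1 / 2 : ℝ) * W t ^ (1 / 2 : ℝ) = W t := fun t ht => by
    rw [← Real.sqrt_eq_rpow, Real.mul_self_sqrt (hWpos t ht).le]
  constructor
  · intro htop
    set C : ℝ := 4 * (1 + (g 0)⁻ ^ (1 / q)) with hC
    have hG0 : 0 ≤ (g 0)⁻ ^ (1 / q) := Real.rpow_nonneg (negPart_nonneg _) _
    have hle : ∀ t ∈ Set.Ioi (0 : ℝ), ENNReal.ofReal (1 / W (2 * t) ^ (1 / 2 : ℝ)) ≤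
        ENNReal.ofReal C * ENNReal.ofReal
          (1 / (t * f t) ^ (1 / 2 : ℝ) + 1 / f t ^ (1 / q)) := by
      intro t ht
      have ht : 0 < t := ht
      have htf := mul_pos ht (hfpos t)
      rw [← ENNReal.ofReal_mul (by positivity)]
      refine ENNReal.ofReal_le_ofReal ?_
      set X := (t * f t) ^ (1 / 2 : ℝ) with hX
      set Y := f t ^ (1 / q) with hY
      have hX0 : 0 < X := Real.rpow_pos_of_pos htf _
      have hY0 : 0 < Y := Real.rpow_pos_of_pos (hfpos t) _
      set S := 1 / X + 1 / Y with hS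
      have hS0 : 0 < S := by positivity
      have hC1 : 4 ≤ C := by linarith
      have hCS : 0 < C * S := by positivity
      have hXS : 1 ≤ X * S := by
        rw [hS, mul_add, mul_one_div_cancel hX0.ne']
        exact le_add_of_nonneg_right (by positivity)
      have hYS : 1 ≤ Y * S := by
        rw [hS, mul_add, mul_one_div_cancel hY0.ne']
        exact le_add_of_nonneg_left (by positivity)
      have hXX : X * X = t * f t := by
        rw [hX, ← Real.sqrt_eq_rpow, Real.mul_self_sqrt htf.le]
      have hkle : ((g t)⁻ / f t) ^ (1 / q) * Y ≤ (g 0)⁻ ^ (1 / q) := by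
        rw [hY, ← Real.mul_rpow (div_nonneg (negPart_nonneg _) (hfpos t).le) (hfpos t).le,
          div_mul_cancel₀ _ (hfpos t).ne']
        exact Real.rpow_le_rpow (negPart_nonneg _) (negPart_anti (hgm ht.le)) (by positivity)
      have hkn : 0 ≤ ((g t)⁻ / f t) ^ (1 / q) :=
        Real.rpow_nonneg (div_nonneg (negPart_nonneg _) (hfpos t).le) _
      -- The 4 in C gives C S X ≥ 4, hence μ = (C S)^(-2) ≤ t f(t)/2; the term with g⁻(0) gives 2
      -- k^(1/2) ≤ C S, hence 4 k μ ≤ 1.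
      have hμ : (1 / (C * S)) ^ 2 ≤ W (2 * t) := by
        refine min_le_dampedIntegral hf hfm hfpos hk hka hk0 ht ?_ ?_
        · have e1 : 2 * ((g t)⁻ / f t) ^ (1 / q) ≤ C * S := by
            have e2 := mul_le_mul_of_nonneg_right hkle hS0.le
            have e3 := mul_le_mul_of_nonneg_left hYS hkn
            have e4 : 2 * (g 0)⁻ ^ (1 / q) * S ≤ C * S :=
              mul_le_mul_of_nonneg_right (by linarith) hS0.le
            linarith
          have e2 : 4 * gradCoeff f g q t ≤ (C * S) ^ 2 := by
            rw [hksqrt]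
            have := mul_self_le_mul_self (by positivity) e1
            linarith
          rw [div_pow, one_pow, mul_one_div, div_le_one (by positivity)]
          exact e2
        · have e1 : 4 ≤ C * S * X := by
            have e2 := mul_le_mul_of_nonneg_left hXS (show 0 ≤ C by linarith)
            linarith
          rw [div_pow, one_pow, div_le_iff₀ (by positivity), ← hXX]
          have := mul_self_le_mul_self (by norm_num) e1
          linarith
      have hW2 := hWpos (2 * t) (by linarith)
      rw [one_div_le (Real.rpow_pos_of_pos hW2 _) hCS, ← Real.sqrt_eq_rpow]
      exact Real.le_sqrt_of_sq_le hμ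
    by_contra hne
    have h1 := setLIntegral_mono' (μ := volume) measurableSet_Ioi hle
    rw [lintegral_const_mul' _ _ ENNReal.ofReal_ne_top] at h1
    rw [setLIntegral_Ioi_comp_two_mul] at htop
    exact ENNReal.mul_ne_top (by simp) (ne_top_of_le_ne_top
      (ENNReal.mul_ne_top ENNReal.ofReal_ne_top hne) h1) htop
  · intro htop
    set C : ℝ := 1 + 1 / m ^ (1 / q) with hC
    have hmq : 0 < m ^ (1 / q) := Real.rpow_pos_of_pos hm _
    have hle : ∀ t ∈ Set.Ioi (0 : ℝ), ENNReal.ofReal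
        (1 / (t * f t) ^ (1 / 2 : ℝ) + 1 / f t ^ (1 / q)) ≤
        ENNReal.ofReal C * ENNReal.ofReal (1 / W t ^ (1 / 2 : ℝ)) := by
      intro t ht
      have ht : 0 < t := ht
      rw [← ENNReal.ofReal_mul (by positivity)]
      refine ENNReal.ofReal_le_ofReal ?_
      have hWt := hWpos t ht
      have hWs : 0 < W t ^ (1 / 2 : ℝ) := Real.rpow_pos_of_pos hWt _
      have hY0 : 0 < f t ^ (1 / q) := Real.rpow_pos_of_pos (hfpos t) _
      have e1 : 1 / (t * f t) ^ (1 / 2 : ℝ) ≤ 1 / W t ^ (1 / 2 : ℝ) :=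
        one_div_le_one_div_of_le hWs (Real.rpow_le_rpow hWt.le
          (dampedIntegral_le_mul hf hfm hfpos hk hka hk0 ht.le) (by norm_num))
      have e2 : m ^ (1 / q) / f t ^ (1 / q) ≤ ((g t)⁻ / f t) ^ (1 / q) := by
        rw [← Real.div_rpow hm.le (hfpos t).le]
        exact Real.rpow_le_rpow (div_nonneg hm.le (hfpos t).le)
          (div_le_div_of_nonneg_right (hGm t) (hfpos t).le) (by positivity)
      have e3 : ((g t)⁻ / f t) ^ (1 / q) * W t ^ (1 / 2 : ℝ) ≤ 1 := by
        have hn : 0 ≤ ((g t)⁻ / f t) ^ (1 / q) * W t ^ (1 / 2 : ℝ) :=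
          mul_nonneg (Real.rpow_nonneg (div_nonneg (negPart_nonneg _) (hfpos t).le) _) hWs.le
        have h1 := two_mul_mul_dampedIntegral_le_one hf hfm hfpos hk hka hk0 ht.le
        have h2 : (((g t)⁻ / f t) ^ (1 / q) * W t ^ (1 / 2 : ℝ)) ^ 2 ≤ 1 := by
          have : (((g t)⁻ / f t) ^ (1 / q) * W t ^ (1 / 2 : ℝ)) ^ 2 = gradCoeff f g q t * W t := by
            rw [mul_pow, sq, sq, hWsq t ht, hksqrt]
          rw [this]
          have : 0 ≤ gradCoeff f g q t * W t := mul_nonneg (hk0 t) hWt.le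
          linarith
        exact (sq_le_one_iff₀ hn).1 h2
      have e4 : 1 / f t ^ (1 / q) ≤ 1 / m ^ (1 / q) * (1 / W t ^ (1 / 2 : ℝ)) := by
        have e5 := (mul_le_mul_of_nonneg_right e2 hWs.le).trans e3
        rw [div_mul_eq_mul_div, div_le_one hY0] at e5
        rw [one_div_mul_one_div]
        exact one_div_le_one_div_of_le (mul_pos hmq hWs) e5
      rw [hC, add_mul, one_mul]
      exact add_le_add e1 e4
    by_contra hne
    have h1 := setLIntegral_mono' (μ := volume) measurableSet_Ioi hle
    rw [lintegral_const_mul' _ _ ENNReal.ofReal_ne_top] at h1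
    exact ne_top_of_le_ne_top (ENNReal.mul_ne_top ENNReal.ofReal_ne_top hne) h1 htop

theorem mainTheorem3 (f g : ℝ → ℝ) (c q : ℝ) (hq : 0 < q) (hq' : q ≤ 2) (hc : 1 ≤ c)
    (hf : Continuous f) (hfm : Monotone f) (hfpos : ∀ t, 0 < f t)
    (hg : Continuous g) (hgm : Monotone g)
    (ℓ : EReal) (hℓ : Tendsto (fun t : ℝ => (g t : EReal)) atTop (𝓝 ℓ)) :
    (∀ (a : ℝ) (R : EReal) (φ : ℝ → ℝ), IsMaximalRadialSolution f g c q a R φ →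
      (0 < ℓ → (R = ⊤ ↔ GrowthConditionPos f g q)) ∧
      (ℓ ≤ 0 → (R = ⊤ ↔ GrowthConditionNonpos f g q))) ∧
    (ℓ < 0 → (GrowthConditionNonpos f g q ↔ GrowthConditionNeg f q)) := by
  -- By monotonicity ℓ bounds g everywhere, so a sign of ℓ becomes a global bound: g ≤ 0 if ℓ ≤ 0,
  -- and g ≤ x for a real x < 0 if ℓ < 0.
  have hle : ∀ t, (g t : EReal) ≤ ℓ := fun t =>
    Monotone.ge_of_tendsto (fun s t hst => EReal.coe_le_coe_iff.2 (hgm hst)) hℓ t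
  refine ⟨fun a R φ h => ⟨fun hpos => ?_, fun hnonpos => ?_⟩, fun hneg => ?_⟩
  · obtain ⟨t, ht, ht0⟩ := ((hℓ.eventually (lt_mem_nhds hpos)).and (eventually_gt_atTop 0)).exists
    exact h.eq_top_iff_growthConditionPos hf hfm hfpos hg hgm hq hq' hc ht0 (EReal.coe_pos.1 ht)
  · exact h.eq_top_iff_growthConditionNonpos hf hfm hfpos hg hgm
      (fun t => EReal.coe_nonpos.1 ((hle t).trans hnonpos)) hq hq' hc
  · obtain ⟨x, hx, hx0⟩ := EReal.lt_iff_exists_real_btwn.1 hneg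
    refine growthConditionNonpos_iff_growthConditionNeg (m := -x) hf hfm hfpos hg hgm
      (neg_pos.2 (EReal.coe_neg'.1 hx0)) (fun t => ?_) hq
    rw [neg_neg]
    exact EReal.coe_le_coe_iff.1 ((hle t).trans hx.le)
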